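/- Conventions. A simplicial category is a category enriched in simplicial sets; $\mathrm{Map}(X,Y)$ denotes the hom-object. A simplicial model category is a model category with a simplicial enrichment that has powers and copowers by all simplicial sets and satisfies Quillen's axiom SM7. A simplicial adjunction is an adjunction whose unit and counit are simplicially natural. A natural transformation $\alpha:S\to T$ of functors between model categories is a Quillen fibration if for every fibration $p:A\to B$ the induced map $SA\to SB\times_{TB}TA$ is a fibration, acyclic if $p$ is; a comonad is Quillen counit-fibrant if its counit is a Quillen fibration. Dually, $\alpha$ is a Quillen cofibration if for every cofibration $i:A\to B$ the map $SB\sqcup_{SA}TA\to TB$ is a cofibration, acyclic if $i$ is; a monad is Quillen unit-cofibrant if its unit is a Quillen cofibration. A map $i:A\to B$ is the inclusion of a simplicial strong deformation retract if there are $r:B\to A$ with $ri=1_A$ and $H:\Delta[1]\to\mathrm{Map}(B,B)$, from $1_B$ to $ir$, whose restriction along $i$ is constant at $i$. Let $\mathcal N$ be a simplicial model category, let $\mathcal M$ be a simplicial category with finite limits, and let $U:\mathcal M\to\mathcal N$ be a simplicial functor with simplicial adjoints $F\dashv U\dashv G$. A map $f$ of $\mathcal M$ is a $U$-fibration if $Uf$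 is a fibration, and an injective fibration if it has the right lifting property against all maps $i$ such that $Ui$ is an acyclic cofibration; an object $X$ is $U$-fibrant (injectively fibrant) if $X\to 1$ is a $U$-fibration (injective fibration). For $X\in\mathcal M$, let $\mathsf C^\bullet(G,UG,UX)$ be the cosimplicial object with $\mathsf C^n=(GU)^{n+1}X=G(UG)^nUX$, whose cofaces are given by the unit $1\to GU$ and codegeneracies by the multiplication $G\varepsilon U$ of the monad $GU$ (the copies of $GU$ being numbered from the innermost one, $0$, to the outermost one, $n$). Suppose that it has a totalization $\mathsf C(G,UG,UX)$ for every $X$, i.e. a limit weighted by $\Delta[\bullet]$ in the simplicially enriched sense, and let $\nu_X:X\to\mathsf C(G,UG,UX)$ be the coaugmentation, induced by the iterated units. For $f:X\to Y$ in $\mathcal M$, let $Ef=Y\times_{\mathsf C(G,UG,UY)}\mathsf C(G,UG,UX)$ be the pullback of $\mathsf C(G,UG,Uf)$ along $\nu_Y$, with projection $\rho_f:Ef\to Y$, and let $\lambda_f=(f,\nu_X):X\to Ef$. Theorem. (a) The comonad $UG$ is Quillen counit-fibrant if and only if the monad $UF$ is Quillen unit-cofibrant. Suppose that $UG$ is Quillen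 counit-fibrant and that all inclusions of simplicial strong deformation retracts in $\mathcal N$ are cofibrations. Then: (b) all inclusions of simplicial strong deformation retracts in $\mathcal N$ are acyclic cofibrations; (c) a map $f:X\to Y$ in $\mathcal M$ is an injective fibration if and only if it is a $U$-fibration and $\lambda_f:X\to Ef$ has a retraction over $Y$, i.e. there is $r:Ef\to X$ with $r\lambda_f=1_X$ and $fr=\rho_f$; (d) in particular, an object $X$ of $\mathcal M$ is injectively fibrant if and only if it is $U$-fibrant and $\nu_X:X\to\mathsf C(G,UG,UX)$ has a retraction. -/

import Mathlib

open CategoryTheory CategoryTheory.Limits CategoryTheory.MonoidalCategory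
open HomotopicalAlgebra
open scoped Simplicial

universe v u₁ u₂

noncomputable section

namespace CobarInj

/-! ### Simplicial functors and simplicial adjunctions -/

section Enriched

variable {C : Type u₁} [Category.{v} C] [SimplicialCategory C]
  {D : Type u₂} [Category.{v} D] [SimplicialCategory D]

/-- The ordinary functor underlying a simplicially enriched functor. -/
def underlying (U : EnrichedFunctor SSet.{v} C D) : C ⥤ D where
  obj X := U.obj X
  map {X Y} f := (eHomEquiv SSet.{v}).symm (eHomEquiv SSet.{v} f ≫ U.map X Y)
  map_id X := by
    rw [eHomEquiv_id, U.map_id, Equiv.symm_apply_eq, eHomEquiv_id]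
  map_comp {X Y Z} f g := by
    rw [Equiv.symm_apply_eq, eHomEquiv_comp, eHomEquiv_comp, Equiv.apply_symm_apply,
      Equiv.apply_symm_apply, Category.assoc, Category.assoc, U.map_comp,
      ← MonoidalCategory.tensorHom_comp_tensorHom_assoc]

/-- A simplicial adjunction: an adjunction between the underlying functors of two simplicial
functors, whose unit and counit are simplicially natural. -/
structure SimplicialAdjunction (L : EnrichedFunctor SSet.{v} C D)
    (R : EnrichedFunctor SSet.{v} D C) where
  /-- the underlying ordinary adjunction -/
  adj : underlying L ⊣ underlying R
  unit_natural (X Y : C) :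
    eHomWhiskerLeft SSet.{v} X (adj.unit.app Y) =
      L.map X Y ≫ R.map (L.obj X) (L.obj Y) ≫
        eHomWhiskerRight SSet.{v} (adj.unit.app X) (R.obj (L.obj Y))
  counit_natural (X Y : D) :
    R.map X Y ≫ L.map (R.obj X) (R.obj Y) ≫
        eHomWhiskerLeft SSet.{v} (L.obj (R.obj X)) (adj.counit.app Y) =
      eHomWhiskerRight SSet.{v} (adj.counit.app X) Y

end Enriched

section Simplicial

variable {C : Type u₁} [Category.{v} C] [SimplicialCategory C]

/-- For `f : X ⟶ Y` and a simplicial set `K`, the map `K ⟶ Map(X, Y)` constant at `f`. -/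
def constMap (K : SSet.{v}) {X Y : C} (f : X ⟶ Y) : K ⟶ (X ⟶[SSet.{v}] Y) :=
  SemiCartesianMonoidalCategory.toUnit K ≫ eHomEquiv SSet.{v} f

/-- `T` is a copower (tensor) of `X` by the simplicial set `K`, with universal map
`ι : K ⟶ Map(X, T)`: for all `Y`, the induced map `Map(T, Y) ⟶ Map(K, Map(X, Y))` is an
isomorphism of simplicial sets (expressed on maps from an arbitrary simplicial set `L`). -/
def IsCopower (K : SSet.{v}) (X T : C) (ι : K ⟶ (X ⟶[SSet.{v}] T)) : Prop :=
  ∀ (Y : C) (L : SSet.{v}) (s : K ⊗ L ⟶ (X ⟶[SSet.{v}] Y)),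
    ∃! h : L ⟶ (T ⟶[SSet.{v}] Y), s = (ι ⊗ₘ h) ≫ eComp SSet.{v} X T Y

/-- `P` is a power (cotensor) of `Y` by the simplicial set `K`, with universal map
`π : K ⟶ Map(P, Y)`: for all `X`, the induced map `Map(X, P) ⟶ Map(K, Map(X, Y))` is an
isomorphism of simplicial sets (expressed on maps from an arbitrary simplicial set `L`). -/
def IsPower (K : SSet.{v}) (Y P : C) (π : K ⟶ (P ⟶[SSet.{v}] Y)) : Prop :=
  ∀ (X : C) (L : SSet.{v}) (s : L ⊗ K ⟶ (X ⟶[SSet.{v}] Y)),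
    ∃! h : L ⟶ (X ⟶[SSet.{v}] P), s = (h ⊗ₘ π) ≫ eComp SSet.{v} X P Y

/-- The map `Map(B, X) ⟶ Map(A, X) ×_{Map(A, Y)} Map(B, Y)` induced by `i : A ⟶ B` and
`p : X ⟶ Y`. -/
def pullbackHom {A B X Y : C} (i : A ⟶ B) (p : X ⟶ Y) :
    (B ⟶[SSet.{v}] X) ⟶
      pullback (eHomWhiskerLeft SSet.{v} A p) (eHomWhiskerRight SSet.{v} i Y) :=
  pullback.lift (eHomWhiskerRight SSet.{v} i X) (eHomWhiskerLeft SSet.{v} B p)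
    (eHom_whisker_exchange SSet.{v} i p).symm

variable (C) in
/-- Simplicial model categories: model categories with a simplicial enrichment that has all powers
and copowers by simplicial sets and satisfies Quillen's axiom SM7. Kan fibrations are the maps
with the right lifting property against horn inclusions, acyclic Kan fibrations those
with the right lifting property against boundary inclusions. -/
class SimplicialModelCategory [ModelCategory C] : Prop where
  exists_copower (K : SSet.{v}) (X : C) :
    ∃ (T : C) (ι : K ⟶ (X ⟶[SSet.{v}] T)), IsCopower K X T ι
  exists_power (K : SSet.{v}) (Y : C) :
    ∃ (P : C) (π : K ⟶ (P ⟶[SSet.{v}] Y)), IsPower K Y P π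
  sm7 {A B X Y : C} (i : A ⟶ B) (p : X ⟶ Y) (_ : cofibrations C i) (_ : fibrations C p) :
    SSet.modelCategoryQuillen.J.rlp (pullbackHom i p)
  sm7_acyclic {A B X Y : C} (i : A ⟶ B) (p : X ⟶ Y) (_ : cofibrations C i)
    (_ : fibrations C p) (_ : weakEquivalences C i ∨ weakEquivalences C p) :
    SSet.modelCategoryQuillen.I.rlp (pullbackHom i p)

/-- `i : A ⟶ B` is the inclusion of a simplicial strong deformation retract: there are a retraction
`r` of `i` and a simplicial homotopy `H`, relative to `A`, from the identity of `B`
to `i ∘ r`. -/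
def IsStrongDeformationRetract {A B : C} (i : A ⟶ B) : Prop :=
  ∃ r : B ⟶ A, i ≫ r = 𝟙 A ∧ ∃ H : Δ[1] ⟶ (B ⟶[SSet.{v}] B),
    -- the endpoint at the vertex `0`
    SSet.stdSimplex.map (SimplexCategory.δ (1 : Fin 2)) ≫ H = constMap _ (𝟙 B) ∧
    -- the endpoint at the vertex `1`
    SSet.stdSimplex.map (SimplexCategory.δ (0 : Fin 2)) ≫ H = constMap _ (r ≫ i) ∧
    -- the homotopy is constant on `A`
    H ≫ eHomWhiskerRight SSet.{v} i B = constMap _ i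

/-! ### Totalizations of cosimplicial objects -/

/-- A totalization of a cosimplicial object `X`, i.e. a limit of `X` weighted by `Δ[•]`: for all
`A`, the simplicial set `Map(A, pt)` is (via `π`) the simplicial set of cosimplicial maps
from `Δ[•]` to `Map(A, X^•)` (expressed on maps from an arbitrary simplicial set `K`). -/
structure Totalization (X : CosimplicialObject C) where
  /-- the totalization -/
  pt : C
  /-- the universal cosimplicial map -/
  π (n : SimplexCategory) : SSet.stdSimplex.{v}.obj n ⟶ (pt ⟶[SSet.{v}] X.obj n)
  w {m n : SimplexCategory} (φ : m ⟶ n) :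
    SSet.stdSimplex.{v}.map φ ≫ π n = π m ≫ eHomWhiskerLeft SSet.{v} pt (X.map φ)
  existsUnique (A : C) (K : SSet.{v})
    (s : ∀ n : SimplexCategory, K ⊗ SSet.stdSimplex.{v}.obj n ⟶ (A ⟶[SSet.{v}] X.obj n))
    (_ : ∀ {m n : SimplexCategory} (φ : m ⟶ n),
      K ◁ SSet.stdSimplex.{v}.map φ ≫ s n = s m ≫ eHomWhiskerLeft SSet.{v} A (X.map φ)) :
    ∃! h : K ⟶ (A ⟶[SSet.{v}] pt), ∀ n, s n = (h ⊗ₘ π n) ≫ eComp SSet.{v} A pt (X.obj n)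

namespace Totalization

variable {X : CosimplicialObject C} (T : Totalization X)

/-- The universal property of the totalization, on morphisms of the underlying category. -/
lemma existsUnique_hom (A : C)
    (s : ∀ n : SimplexCategory, SSet.stdSimplex.{v}.obj n ⟶ (A ⟶[SSet.{v}] X.obj n))
    (hs : ∀ {m n : SimplexCategory} (φ : m ⟶ n),
      SSet.stdSimplex.{v}.map φ ≫ s n = s m ≫ eHomWhiskerLeft SSet.{v} A (X.map φ)) :
    ∃! f : A ⟶ T.pt, ∀ n, s n = T.π n ≫ eHomWhiskerRight SSet.{v} f (X.obj n) := by
  obtain ⟨h, hh, hu⟩ := T.existsUnique A (𝟙_ SSet.{v}) (fun n ↦ (λ_ _).hom ≫ s n) (by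
    intro m n φ
    rw [Category.assoc, ← hs, MonoidalCategory.leftUnitor_naturality_assoc])
  have key (k : 𝟙_ SSet.{v} ⟶ (A ⟶[SSet.{v}] T.pt)) (n : SimplexCategory) :
      ((λ_ _).hom ≫ s n = (k ⊗ₘ T.π n) ≫ eComp SSet.{v} A T.pt (X.obj n)) ↔
        s n = T.π n ≫ eHomWhiskerRight SSet.{v} ((eHomEquiv SSet.{v}).symm k) (X.obj n) := by
    rw [eHomWhiskerRight, Equiv.apply_symm_apply,
      MonoidalCategory.leftUnitor_inv_naturality_assoc,
      ← MonoidalCategory.tensorHom_def'_assoc, Iso.eq_inv_comp]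
  refine ⟨(eHomEquiv SSet.{v}).symm h, fun n ↦ (key h n).1 (hh n), fun f hf ↦ ?_⟩
  rw [Equiv.eq_symm_apply]
  refine hu _ (fun n ↦ (key _ n).2 ?_)
  rw [Equiv.symm_apply_apply]
  exact hf n

/-- The morphism `A ⟶ T.pt` induced by a cosimplicial map `Δ[•] ⟶ Map(A, X^•)`. -/
def lift (A : C)
    (s : ∀ n : SimplexCategory, SSet.stdSimplex.{v}.obj n ⟶ (A ⟶[SSet.{v}] X.obj n))
    (hs : ∀ {m n : SimplexCategory} (φ : m ⟶ n),
      SSet.stdSimplex.{v}.map φ ≫ s n = s m ≫ eHomWhiskerLeft SSet.{v} A (X.map φ)) :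
    A ⟶ T.pt :=
  (T.existsUnique_hom A s hs).choose

lemma lift_fac (A : C)
    (s : ∀ n : SimplexCategory, SSet.stdSimplex.{v}.obj n ⟶ (A ⟶[SSet.{v}] X.obj n))
    (hs : ∀ {m n : SimplexCategory} (φ : m ⟶ n),
      SSet.stdSimplex.{v}.map φ ≫ s n = s m ≫ eHomWhiskerLeft SSet.{v} A (X.map φ))
    (n : SimplexCategory) :
    T.π n ≫ eHomWhiskerRight SSet.{v} (T.lift A s hs) (X.obj n) = s n :=
  ((T.existsUnique_hom A s hs).choose_spec.1 n).symm

lemma hom_ext {A : C} {f g : A ⟶ T.pt}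
    (h : ∀ n, T.π n ≫ eHomWhiskerRight SSet.{v} f (X.obj n) =
      T.π n ≫ eHomWhiskerRight SSet.{v} g (X.obj n)) : f = g := by
  refine (T.existsUnique_hom A
    (fun n ↦ T.π n ≫ eHomWhiskerRight SSet.{v} g (X.obj n)) ?_).unique
      (fun n ↦ (h n).symm) (fun n ↦ rfl)
  intro m n φ
  have e := eHom_whisker_exchange SSet.{v} g (X.map φ)
  calc _ = (SSet.stdSimplex.map φ ≫ T.π n) ≫ eHomWhiskerRight SSet.{v} g (X.obj n) :=
        (Category.assoc _ _ _).symm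
    _ = (T.π m ≫ eHomWhiskerLeft SSet.{v} T.pt (X.map φ)) ≫
          eHomWhiskerRight SSet.{v} g (X.obj n) := by rw [T.w φ]
    _ = T.π m ≫ eHomWhiskerLeft SSet.{v} T.pt (X.map φ) ≫
          eHomWhiskerRight SSet.{v} g (X.obj n) := Category.assoc _ _ _
    _ = T.π m ≫ eHomWhiskerRight SSet.{v} g (X.obj m) ≫
          eHomWhiskerLeft SSet.{v} A (X.map φ) := congrArg _ e
    _ = _ := (Category.assoc _ _ _).symm

lemma constMap_comp_whiskerLeft (K : SSet.{v}) {A Y Z : C} (f : A ⟶ Y) (g : Y ⟶ Z) :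
    constMap K f ≫ eHomWhiskerLeft SSet.{v} A g = constMap K (f ≫ g) := by
  rw [constMap, constMap, eHomEquiv_comp, Category.assoc, eHomWhiskerLeft,
    MonoidalCategory.rightUnitor_inv_naturality_assoc,
    ← MonoidalCategory.tensorHom_def_assoc, MonoidalCategory.unitors_inv_equal]

lemma constMap_comp_whiskerRight (K : SSet.{v}) {A Y Z : C} (f : A ⟶ Y) (g : Y ⟶ Z) :
    constMap K g ≫ eHomWhiskerRight SSet.{v} f Z = constMap K (f ≫ g) := by
  rw [constMap, constMap, eHomEquiv_comp, Category.assoc, eHomWhiskerRight,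
    MonoidalCategory.leftUnitor_inv_naturality_assoc,
    ← MonoidalCategory.tensorHom_def'_assoc]

lemma comp_constMap {K L : SSet.{v}} (a : K ⟶ L) {A Y : C} (f : A ⟶ Y) :
    a ≫ constMap L f = constMap K f := by
  simp [constMap]

end Totalization

end Simplicial

/-! ### The cobar resolution of a monad -/

section Cobar

variable {C : Type u₁} [Category.{v} C] (T : Monad C)

/-- The iterates `T^n X`. -/
def iter (X : C) (n : ℕ) : C :=
  match n with
  | 0 => X
  | n + 1 => T.obj (iter X n)

/-- `T` applied to a map between iterates. -/
def iterT {X Y : C} {m n : ℕ} (f : iter T X m ⟶ iter T Y n) :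
    iter T X (m + 1) ⟶ iter T Y (n + 1) :=
  T.map f

/-- The unit of `T` at `T^n X`. -/
def iterUnit (X : C) (n : ℕ) : iter T X n ⟶ iter T X (n + 1) := T.η.app (iter T X n)

/-- The multiplication of `T` at `T^n X`. -/
def iterMul (X : C) (n : ℕ) : iter T X (n + 2) ⟶ iter T X (n + 1) := T.μ.app (iter T X n)

lemma iterT_id (X : C) (n : ℕ) : iterT T (𝟙 (iter T X n)) = 𝟙 (iter T X (n + 1)) :=
  T.map_id _

lemma iterT_comp {X Y Z : C} {m n k : ℕ} (f : iter T X m ⟶ iter T Y n)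
    (g : iter T Y n ⟶ iter T Z k) : iterT T (f ≫ g) = iterT T f ≫ iterT T g :=
  T.map_comp _ _

lemma iterUnit_naturality {X Y : C} {m n : ℕ} (f : iter T X m ⟶ iter T Y n) :
    iterUnit T X m ≫ iterT T f = f ≫ iterUnit T Y n :=
  (T.η.naturality f).symm

lemma iterMul_naturality {X Y : C} {m n : ℕ} (f : iter T X m ⟶ iter T Y n) :
    iterMul T X m ≫ iterT T f = iterT T (iterT T f) ≫ iterMul T Y n :=
  (T.μ.naturality f).symm

lemma iterMul_assoc (X : C) (n : ℕ) :
    iterMul T X (n + 1) ≫ iterMul T X n = iterT T (iterMul T X n) ≫ iterMul T X n :=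
  (T.assoc _).symm

lemma iterUnit_mul (X : C) (n : ℕ) : iterUnit T X (n + 1) ≫ iterMul T X n = 𝟙 _ :=
  T.left_unit _

lemma iterT_unit_mul (X : C) (n : ℕ) : iterT T (iterUnit T X n) ≫ iterMul T X n = 𝟙 _ :=
  T.right_unit _

/-- The restriction of a monotone map along the inclusion of the first `m` elements. -/
def init {m n : ℕ} (φ : Fin (m + 1) →o Fin n) : Fin m →o Fin n :=
  ⟨fun i ↦ φ i.castSucc, fun _ _ h ↦ φ.monotone (Fin.castSucc_le_castSucc_iff.2 h)⟩

/-- The corestriction of a monotone map which does not attain the last element. -/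
def corestrict {m n : ℕ} (φ : Fin (m + 1) →o Fin (n + 1)) (h : φ (Fin.last m) ≠ Fin.last n) :
    Fin (m + 1) →o Fin n :=
  ⟨fun i ↦ (φ i).castLT (lt_of_le_of_lt (φ.monotone (Fin.le_last i)) (Fin.val_lt_last h)),
    fun _ _ h ↦ φ.monotone h⟩

/-- The unique map from the empty ordinal. -/
def emptyMap (n : ℕ) : Fin 0 →o Fin n := ⟨fun i ↦ i.elim0, fun i ↦ i.elim0⟩

/-- The morphism `T^m X ⟶ T^n X` attached to a monotone map `φ` from `m = {0, …, m - 1}` to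
`n = {0, …, n - 1}`: over each `j ∈ n`, it multiplies together the copies of `T` indexed
by the fibre of `φ` at `j` (using the unit of `T` if this fibre is empty). The outermost copy
of `T` corresponds to the last element. -/
def iterMap (X : C) (m n : ℕ) (φ : Fin m →o Fin n) : iter T X m ⟶ iter T X n :=
  match m, n, φ with
  | 0, 0, _ => 𝟙 (iter T X 0)
  | 0, n + 1, _ => iterMap X 0 n (emptyMap n) ≫ iterUnit T X n
  | _ + 1, 0, φ => (φ 0).elim0
  | m + 1, n + 1, φ =>
    if h : φ (Fin.last m) = Fin.last n then
      iterT T (iterMap X m (n + 1) (init φ)) ≫ iterMul T X n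
    else iterMap X (m + 1) n (corestrict φ h) ≫ iterUnit T X n
termination_by (m, n)

/-- The map `T^n X ⟶ T^n Y` induced by `f : X ⟶ Y`. -/
def iterHom {X Y : C} (f : X ⟶ Y) (n : ℕ) : iter T X n ⟶ iter T Y n :=
  match n with
  | 0 => f
  | n + 1 => iterT T (iterHom f n)

lemma iterHom_succ {X Y : C} (f : X ⟶ Y) (n : ℕ) :
    iterHom T f (n + 1) = iterT T (iterHom T f n) := rfl

lemma iterMap_zero_zero (X : C) (φ : Fin 0 →o Fin 0) : iterMap T X 0 0 φ = 𝟙 _ := by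
  rw [iterMap]

lemma iterMap_zero_succ (X : C) (n : ℕ) (φ : Fin 0 →o Fin (n + 1)) :
    iterMap T X 0 (n + 1) φ = iterMap T X 0 n (emptyMap n) ≫ iterUnit T X n := by
  rw [iterMap]

lemma iterMap_of_eq (X : C) {m n : ℕ} (φ : Fin (m + 1) →o Fin (n + 1))
    (h : φ (Fin.last m) = Fin.last n) :
    iterMap T X (m + 1) (n + 1) φ =
      iterT T (iterMap T X m (n + 1) (init φ)) ≫ iterMul T X n := by
  rw [iterMap, dif_pos h]

lemma iterMap_of_ne (X : C) {m n : ℕ} (φ : Fin (m + 1) →o Fin (n + 1))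
    (h : φ (Fin.last m) ≠ Fin.last n) :
    iterMap T X (m + 1) (n + 1) φ =
      iterMap T X (m + 1) n (corestrict φ h) ≫ iterUnit T X n := by
  rw [iterMap, dif_neg h]

lemma hom_zero_ext {n : ℕ} (φ ψ : Fin 0 →o Fin n) : φ = ψ := by
  ext i; exact i.elim0

lemma iterUnit_iterMap (X : C) {n k : ℕ} (ψ : Fin (n + 1) →o Fin (k + 1))
    (hψ : ψ (Fin.last n) = Fin.last k) :
    iterUnit T X n ≫ iterMap T X (n + 1) (k + 1) ψ = iterMap T X n (k + 1) (init ψ) := by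
  rw [iterMap_of_eq T X ψ hψ, ← Category.assoc, iterUnit_naturality, Category.assoc,
    iterUnit_mul, Category.comp_id]

lemma iterMap_comp (X : C) (m n k : ℕ) (φ : Fin m →o Fin n) (ψ : Fin n →o Fin k) :
    iterMap T X m n φ ≫ iterMap T X n k ψ = iterMap T X m k (ψ.comp φ) := by
  match m, n, k, φ, ψ with
  | 0, 0, k, φ, ψ =>
    rw [iterMap_zero_zero, Category.id_comp, hom_zero_ext (ψ.comp φ) ψ]
  | m + 1, 0, k, φ, ψ => exact (φ 0).elim0
  | m, n + 1, 0, φ, ψ => exact (ψ 0).elim0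
  | 0, n + 1, k + 1, φ, ψ =>
    by_cases hψ : ψ (Fin.last n) = Fin.last k
    · rw [iterMap_zero_succ, Category.assoc, iterUnit_iterMap T X ψ hψ,
        iterMap_comp X 0 n (k + 1) (emptyMap n) (init ψ)]
      exact congrArg _ (hom_zero_ext _ _)
    · rw [iterMap_of_ne T X ψ hψ, ← Category.assoc,
        iterMap_comp X 0 (n + 1) k φ (corestrict ψ hψ), iterMap_zero_succ,
        hom_zero_ext (OrderHom.comp (corestrict ψ hψ) φ) (emptyMap k)]
  | m + 1, n + 1, k + 1, φ, ψ =>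
    by_cases hψ : ψ (Fin.last n) = Fin.last k
    · by_cases hφ : φ (Fin.last m) = Fin.last n
      · have h : (ψ.comp φ) (Fin.last m) = Fin.last k := by simp [hφ, hψ]
        have ih := iterMap_comp X m (n + 1) (k + 1) (init φ) ψ
        have e : init (ψ.comp φ) = ψ.comp (init φ) := rfl
        rw [iterMap_of_eq T X _ h, iterMap_of_eq T X φ hφ, e, ← ih, iterMap_of_eq T X ψ hψ,
          iterT_comp, iterT_comp, Category.assoc, Category.assoc, Category.assoc,
          ← iterMul_assoc, ← Category.assoc (iterMul T X n), iterMul_naturality, Category.assoc]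
      · rw [iterMap_of_ne T X φ hφ, Category.assoc, iterUnit_iterMap T X ψ hψ,
          iterMap_comp X (m + 1) n (k + 1) (corestrict φ hφ) (init ψ)]
        rfl
    · have h : (ψ.comp φ) (Fin.last m) ≠ Fin.last k := fun h ↦ hψ (by
        refine le_antisymm (Fin.le_last _) ?_
        rw [← h]
        exact ψ.monotone (Fin.le_last _))
      rw [iterMap_of_ne T X ψ hψ, ← Category.assoc,
        iterMap_comp X (m + 1) (n + 1) k φ (corestrict ψ hψ), iterMap_of_ne T X _ h]
      rfl
termination_by (m, n, k)

lemma iterMap_naturality {X Y : C} (f : X ⟶ Y) (m n : ℕ) (φ : Fin m →o Fin n) :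
    iterMap T X m n φ ≫ iterHom T f n = iterHom T f m ≫ iterMap T Y m n φ := by
  match m, n, φ with
  | 0, 0, φ => rw [iterMap_zero_zero, iterMap_zero_zero, Category.id_comp, Category.comp_id]
  | 0, n + 1, φ =>
    have ih := iterMap_naturality f 0 n (emptyMap n)
    rw [iterMap_zero_succ, iterMap_zero_succ, ← Category.assoc, ← ih, Category.assoc,
      Category.assoc, iterHom_succ, iterUnit_naturality]
  | _ + 1, 0, φ => exact (φ 0).elim0
  | m + 1, n + 1, φ =>
    by_cases h : φ (Fin.last m) = Fin.last n
    · have ih := iterMap_naturality f m (n + 1) (init φ)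
      rw [iterMap_of_eq T X φ h, iterMap_of_eq T Y φ h, Category.assoc, iterHom_succ,
        iterMul_naturality, ← iterHom_succ, ← Category.assoc, ← iterT_comp, ih, iterT_comp,
        Category.assoc, ← iterHom_succ]
    · have ih := iterMap_naturality f (m + 1) n (corestrict φ h)
      rw [iterMap_of_ne T X φ h, iterMap_of_ne T Y φ h, ← Category.assoc, ← ih, Category.assoc,
        Category.assoc, iterHom_succ T f n, iterUnit_naturality]
termination_by (m, n)

lemma iterMap_castSucc (X : C) (n : ℕ) :
    iterMap T X n (n + 1) ⟨Fin.castSucc, fun _ _ h ↦ h⟩ =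
      iterMap T X n n OrderHom.id ≫ iterUnit T X n := by
  match n with
  | 0 => rw [iterMap_zero_succ, hom_zero_ext (emptyMap 0) OrderHom.id]
  | n + 1 =>
    rw [iterMap_of_ne T X _ (Fin.castSucc_lt_last (Fin.last n)).ne]
    rfl

lemma iterMap_id (X : C) (n : ℕ) : iterMap T X n n OrderHom.id = 𝟙 (iter T X n) := by
  induction n with
  | zero => rw [iterMap_zero_zero]
  | succ n ih =>
    have e : init (OrderHom.id : Fin (n + 1) →o Fin (n + 1)) =
      ⟨Fin.castSucc, fun _ _ h ↦ h⟩ := rfl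
    rw [iterMap_of_eq T X _ rfl, e, iterMap_castSucc, ih, Category.id_comp, iterT_unit_mul]

/-- The cosimplicial cobar resolution of `X`: it is `T^(n + 1) X` in degree `n`, the cofaces are
given by the unit of `T` and the codegeneracies by the multiplication of `T`. -/
def cobar (X : C) : CosimplicialObject C where
  obj n := iter T X (n.len + 1)
  map {m n} φ := iterMap T X (m.len + 1) (n.len + 1) φ.toOrderHom
  map_id n := iterMap_id T X (n.len + 1)
  map_comp φ ψ := (iterMap_comp T X _ _ _ φ.toOrderHom ψ.toOrderHom).symm

/-- The coaugmentation `X ⟶ T^(n + 1) X`. -/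
def cobarCoaug (X : C) (n : SimplexCategory) : X ⟶ (cobar T X).obj n :=
  iterMap T X 0 (n.len + 1) (emptyMap _)

lemma cobarCoaug_map (X : C) {m n : SimplexCategory} (φ : m ⟶ n) :
    cobarCoaug T X m ≫ (cobar T X).map φ = cobarCoaug T X n :=
  (iterMap_comp T X _ _ _ _ _).trans (congrArg _ (hom_zero_ext _ _))

/-- The cobar resolution is functorial. -/
def cobarMap {X Y : C} (f : X ⟶ Y) : cobar T X ⟶ cobar T Y where
  app n := iterHom T f (n.len + 1)
  naturality _ _ φ := iterMap_naturality T f _ _ φ.toOrderHom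

lemma cobarCoaug_naturality {X Y : C} (f : X ⟶ Y) (n : SimplexCategory) :
    cobarCoaug T X n ≫ (cobarMap T f).app n = f ≫ cobarCoaug T Y n :=
  iterMap_naturality T f 0 _ _

end Cobar

/-! ### The cobar construction and the relative cobar construction -/

section CobarConstruction

variable {C : Type u₁} [Category.{v} C] [SimplicialCategory C] (T : Monad C)
  (Tot : ∀ X : C, Totalization (cobar T X))

lemma nu_aux (X : C) {m n : SimplexCategory} (φ : m ⟶ n) :
    SSet.stdSimplex.{v}.map φ ≫ constMap _ (cobarCoaug T X n) =
      constMap _ (cobarCoaug T X m) ≫ eHomWhiskerLeft SSet.{v} X ((cobar T X).map φ) := by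
  rw [Totalization.constMap_comp_whiskerLeft, cobarCoaug_map]
  exact Totalization.comp_constMap _ _

/-- The coaugmentation `ν_X : X ⟶ Tot (T^(• + 1) X)` of the cobar construction. -/
def nu (X : C) : X ⟶ (Tot X).pt :=
  (Tot X).lift X (fun n ↦ constMap _ (cobarCoaug T X n)) (nu_aux T X)

lemma nu_fac (X : C) (n : SimplexCategory) :
    (Tot X).π n ≫ eHomWhiskerRight SSet.{v} (nu T Tot X) ((cobar T X).obj n) =
      constMap _ (cobarCoaug T X n) :=
  (Tot X).lift_fac _ _ (nu_aux T X) n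

lemma totMap_aux {X Y : C} (f : X ⟶ Y) {m n : SimplexCategory} (φ : m ⟶ n) :
    SSet.stdSimplex.{v}.map φ ≫ (Tot X).π n ≫
        eHomWhiskerLeft SSet.{v} (Tot X).pt ((cobarMap T f).app n) =
      ((Tot X).π m ≫ eHomWhiskerLeft SSet.{v} (Tot X).pt ((cobarMap T f).app m)) ≫
        eHomWhiskerLeft SSet.{v} (Tot X).pt ((cobar T Y).map φ) := by
  have e := (Tot X).w φ
  have nat := (cobarMap T f).naturality φ
  rw [← Category.assoc]
  erw [e]
  rw [Category.assoc, Category.assoc, ← eHomWhiskerLeft_comp, ← eHomWhiskerLeft_comp, nat]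

/-- The map `Tot (T^(• + 1) X) ⟶ Tot (T^(• + 1) Y)` induced by `f : X ⟶ Y`. -/
def totMap {X Y : C} (f : X ⟶ Y) : (Tot X).pt ⟶ (Tot Y).pt :=
  (Tot Y).lift (Tot X).pt
    (fun n ↦ (Tot X).π n ≫ eHomWhiskerLeft SSet.{v} (Tot X).pt ((cobarMap T f).app n))
    (totMap_aux T Tot f)

lemma totMap_fac {X Y : C} (f : X ⟶ Y) (n : SimplexCategory) :
    (Tot Y).π n ≫ eHomWhiskerRight SSet.{v} (totMap T Tot f) ((cobar T Y).obj n) =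
      (Tot X).π n ≫ eHomWhiskerLeft SSet.{v} (Tot X).pt ((cobarMap T f).app n) :=
  (Tot Y).lift_fac _ _ (totMap_aux T Tot f) n

lemma nu_naturality {X Y : C} (f : X ⟶ Y) :
    f ≫ nu T Tot Y = nu T Tot X ≫ totMap T Tot f := by
  refine (Tot Y).hom_ext (fun n ↦ ?_)
  rw [eHomWhiskerRight_comp, eHomWhiskerRight_comp, ← Category.assoc, ← Category.assoc,
    nu_fac, totMap_fac, Category.assoc, eHom_whisker_exchange, ← Category.assoc, nu_fac,
    Totalization.constMap_comp_whiskerLeft, Totalization.constMap_comp_whiskerRight,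
    cobarCoaug_naturality]

variable [HasPullbacks C]

/-- The relative cobar construction `E f` of `f : X ⟶ Y`: the pullback
of `Tot (T^(• + 1) f)` along `ν_Y`. -/
abbrev relCobar {X Y : C} (f : X ⟶ Y) : C :=
  pullback (nu T Tot Y) (totMap T Tot f)

/-- The map `ρ_f : E f ⟶ Y`. -/
abbrev rho {X Y : C} (f : X ⟶ Y) : relCobar T Tot f ⟶ Y :=
  pullback.fst (nu T Tot Y) (totMap T Tot f)

/-- The map `λ_f : X ⟶ E f`, with components `f` and `ν_X`. -/
abbrev lam {X Y : C} (f : X ⟶ Y) : X ⟶ relCobar T Tot f :=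
  pullback.lift f (nu T Tot X) (nu_naturality T Tot f)

end CobarConstruction

/-! ### Quillen (co)fibrations of functors -/

section Quillen

variable {C : Type u₁} [Category.{v} C] [ModelCategory C]
  {D : Type u₂} [Category.{v} D] [ModelCategory D]

/-- `α : S ⟶ T` is a Quillen cofibration: for every cofibration `i : A ⟶ B`, the induced
map from the pushout of `S B ⟵ S A ⟶ T A` to `T B` is a cofibration, acyclic if `i` is. -/
def IsQuillenCofibration {S T : C ⥤ D} (α : S ⟶ T) : Prop :=
  ∀ ⦃A B : C⦄ (i : A ⟶ B), cofibrations C i →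
    cofibrations D (pushout.desc (α.app B) (T.map i) (α.naturality i) :
      pushout (S.map i) (α.app A) ⟶ T.obj B) ∧
    (weakEquivalences C i →
      weakEquivalences D (pushout.desc (α.app B) (T.map i) (α.naturality i) :
        pushout (S.map i) (α.app A) ⟶ T.obj B))

/-- `α : S ⟶ T` is a Quillen fibration: for every fibration `p : A ⟶ B`, the induced
map from `S A` to the pullback of `S B ⟶ T B ⟵ T A` is a fibration, acyclic if `p` is. -/
def IsQuillenFibration {S T : C ⥤ D} (α : S ⟶ T) : Prop :=
  ∀ ⦃A B : C⦄ (p : A ⟶ B), fibrations C p →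
    fibrations D (pullback.lift (S.map p) (α.app A) (α.naturality p) :
      S.obj A ⟶ pullback (α.app B) (T.map p)) ∧
    (weakEquivalences C p →
      weakEquivalences D (pullback.lift (S.map p) (α.app A) (α.naturality p) :
        S.obj A ⟶ pullback (α.app B) (T.map p)))

/-- A monad is Quillen unit-cofibrant if its unit is a Quillen cofibration. -/
def QuillenUnitCofibrant (T : Monad C) : Prop := IsQuillenCofibration T.η

/-- A comonad is Quillen counit-fibrant if its counit is a Quillen fibration. -/
def QuillenCounitFibrant (T : Comonad C) : Prop := IsQuillenFibration T.ε

end Quillen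

/-! ### Injective fibrations -/

section Injective

variable {C : Type u₁} [Category.{v} C] {D : Type u₂} [Category.{v} D] [ModelCategory D]
  (U : C ⥤ D)

/-- The `U`-fibrations: the morphisms sent by `U` to fibrations. -/
def uFibrations : MorphismProperty C := (fibrations D).inverseImage U

/-- The `U`-acyclic `U`-cofibrations: the morphisms sent by `U` to acyclic cofibrations. -/
def uTrivialCofibrations : MorphismProperty C := (trivialCofibrations D).inverseImage U

/-- The injective fibrations: the morphisms with the right lifting property against
all `U`-acyclic `U`-cofibrations. -/
def injectiveFibrations : MorphismProperty C := (uTrivialCofibrations U).rlp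

end Injective

end CobarInj

end

open CobarInj

/-! The functors satisfy `UF ⊣ UG` (`transpose`), and under this adjunction the unit of `UF` and the
counit of `UG` are mates. Hence the corner map of the unit at `i` lifts against `p` exactly when `i`
lifts against the corner map of the counit at `p` (`hasLiftingProperty_leibniz_iff`). Part (a)
follows, since all the classes involved are characterized by lifting.

For (b), let `i : A ⟶ B` be a cofibration and a strong deformation retract, and let `p : X ⟶ Y` be a
fibration. The homotopy gives an edge of `Map(A, X) ×_{Map(A, Y)} Map(B, Y)` from a given lifting
problem to one that the retraction solves. By SM7 this edge lifts to `Map(B, X)`, and its initial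
vertex solves the original problem.

Part (c) is the retract argument for the factorization of `f` as `λ_f` followed by `ρ_f`, and needs
three facts. (1) An injective fibration is a `U`-fibration, because `UF` preserves acyclic
cofibrations (`trivialCofibrations_umap_umap`). (2) If `f` is a `U`-fibration, then its map of
totalizations is an injective fibration (`injectiveFibrations_totMap`), hence so is its pullback
`ρ_f`. This is a Reedy induction over cosimplicial degrees. At each degree the new simplex has
prescribed boundary and codegeneracies. SM7 absorbs the boundary into a pushout-product. The
codegeneracies are removed one by one by transposing along `UF ⊣ UG`, which replaces an acyclic
cofibration by its corner map with the unit (`exists_matching_lift`). (3) `U λ_f` is the inclusion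
of a strong deformation retract (`isStrongDeformationRetract_lam`). After applying `U` the counit
supplies an extra codegeneracy. An `n`-simplex of `Δ[1]` is a monotone map to `{0, 1}`; collapsing
the copies of `UG` on which it takes the value `1` is compatible with all cosimplicial operators and
defines the homotopy. Since `U` is a simplicial right adjoint, it preserves totalizations and
pullbacks, so the homotopy can be built degreewise and then carried over to `E f`. -/

noncomputable section

namespace CobarInj

/-! ### Constant families and simplicial functors on underlying morphisms -/

section EnrichedBasics

variable {C : Type u₁} [Category.{v} C] [SimplicialCategory C]

/-- Composition with a constant family on the left is restriction. -/
lemma constMap_tensorHom_eComp {K L : SSet.{v}} {X Y Z : C} (f : X ⟶ Y)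
    (g : L ⟶ (Y ⟶[SSet.{v}] Z)) :
    (constMap K f ⊗ₘ g) ≫ eComp SSet.{v} X Y Z =
      CartesianMonoidalCategory.snd K L ≫ g ≫ eHomWhiskerRight SSet.{v} f Z := by
  have h : (SemiCartesianMonoidalCategory.toUnit K ⊗ₘ g) =
      CartesianMonoidalCategory.snd K L ≫ g ≫ (λ_ _).inv := by
    rw [← Category.assoc, Iso.eq_comp_inv, CartesianMonoidalCategory.leftUnitor_hom]
    simp
  rw [constMap, eHomWhiskerRight, ← Category.comp_id g,
    ← MonoidalCategory.tensorHom_comp_tensorHom, h, MonoidalCategory.tensorHom_id]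
  simp only [Category.assoc, Category.comp_id]

/-- Associativity of composition, in the form that moves a fixed middle map from one factor to the
other. -/
lemma whiskerLeft_tensorHom_eComp {K L : SSet.{v}} {X Y Y' Z : C} (g : Y ⟶ Y')
    (a : K ⟶ (X ⟶[SSet.{v}] Y)) (b : L ⟶ (Y' ⟶[SSet.{v}] Z)) :
    (a ≫ eHomWhiskerLeft SSet.{v} X g ⊗ₘ b) ≫ eComp SSet.{v} X Y' Z =
      (a ⊗ₘ b ≫ eHomWhiskerRight SSet.{v} g Z) ≫ eComp SSet.{v} X Y Z := by
  have h : eHomWhiskerLeft SSet.{v} X g ▷ _ ≫ eComp SSet.{v} X Y' Z =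
      _ ◁ eHomWhiskerRight SSet.{v} g Z ≫ eComp SSet.{v} X Y Z := by
    dsimp [eHomWhiskerLeft, eHomWhiskerRight]
    simp only [MonoidalCategory.whiskerLeft_comp_assoc, whisker_assoc_symm,
      triangle_assoc_comp_left_inv_assoc, e_assoc', Category.assoc,
      MonoidalCategory.comp_whiskerRight]
  rw [show (a ≫ eHomWhiskerLeft SSet.{v} X g ⊗ₘ b) = (a ⊗ₘ b) ≫ eHomWhiskerLeft SSet.{v} X g ▷ _ by
    simp [MonoidalCategory.tensorHom_def, MonoidalCategory.whisker_exchange], Category.assoc, h,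
    show (a ⊗ₘ b ≫ eHomWhiskerRight SSet.{v} g Z) = (a ⊗ₘ b) ≫ _ ◁ eHomWhiskerRight SSet.{v} g Z by
    simp [MonoidalCategory.tensorHom_def], Category.assoc]

/-- Maps into a simplicial hom from a terminal simplicial set are constant. -/
lemma exists_eq_constMap {K : SSet.{v}} (hK : IsTerminal K) {X Y : C}
    (s : K ⟶ (X ⟶[SSet.{v}] Y)) : ∃ f : X ⟶ Y, s = constMap K f := by
  let e : 𝟙_ SSet.{v} ⟶ K := hK.from _
  refine ⟨(eHomEquiv SSet.{v}).symm (e ≫ s), ?_⟩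
  rw [constMap, Equiv.apply_symm_apply, ← Category.assoc, hK.hom_ext (_ ≫ e) (𝟙 K), Category.id_comp]

variable {D : Type u₂} [Category.{v} D] [SimplicialCategory D]

/-- The action of a simplicial functor on morphisms of the underlying category. -/
def umap (U : EnrichedFunctor SSet.{v} C D) {X Y : C} (f : X ⟶ Y) : U.obj X ⟶ U.obj Y :=
  (underlying U).map f

lemma umap_id (U : EnrichedFunctor SSet.{v} C D) (X : C) : umap U (𝟙 X) = 𝟙 (U.obj X) :=
  (underlying U).map_id X

lemma umap_comp (U : EnrichedFunctor SSet.{v} C D) {X Y Z : C} (f : X ⟶ Y) (g : Y ⟶ Z) :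
    umap U (f ≫ g) = umap U f ≫ umap U g :=
  (underlying U).map_comp f g

lemma umap_comp_assoc (U : EnrichedFunctor SSet.{v} C D) {X Y Z : C} (f : X ⟶ Y) (g : Y ⟶ Z)
    {W : D} (h : U.obj Z ⟶ W) : umap U (f ≫ g) ≫ h = umap U f ≫ umap U g ≫ h := by
  rw [umap_comp, Category.assoc]

lemma eHomEquiv_umap (U : EnrichedFunctor SSet.{v} C D) {X Y : C} (f : X ⟶ Y) :
    eHomEquiv SSet.{v} (umap U f) = eHomEquiv SSet.{v} f ≫ U.map X Y :=
  Equiv.apply_symm_apply _ _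

lemma whiskerLeft_map (U : EnrichedFunctor SSet.{v} C D) (X : C) {Y Y' : C} (g : Y ⟶ Y') :
    eHomWhiskerLeft SSet.{v} X g ≫ U.map X Y' =
      U.map X Y ≫ eHomWhiskerLeft SSet.{v} (U.obj X) (umap U g) := by
  rw [eHomWhiskerLeft, eHomWhiskerLeft, eHomEquiv_umap]
  simp only [Category.assoc, MonoidalCategory.whiskerLeft_comp, U.map_comp]
  rw [MonoidalCategory.rightUnitor_inv_naturality_assoc, MonoidalCategory.tensorHom_def'_assoc,
    MonoidalCategory.whisker_exchange_assoc, MonoidalCategory.whisker_exchange_assoc]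

lemma whiskerLeft_map_assoc (U : EnrichedFunctor SSet.{v} C D) (X : C) {Y Y' : C} (g : Y ⟶ Y')
    {Z : SSet.{v}} (h : (U.obj X ⟶[SSet.{v}] U.obj Y') ⟶ Z) :
    eHomWhiskerLeft SSet.{v} X g ≫ U.map X Y' ≫ h =
      U.map X Y ≫ eHomWhiskerLeft SSet.{v} (U.obj X) (umap U g) ≫ h := by
  rw [← Category.assoc, whiskerLeft_map, Category.assoc]

lemma whiskerRight_map (U : EnrichedFunctor SSet.{v} C D) {X X' : C} (g : X ⟶ X') (Y : C) :
    eHomWhiskerRight SSet.{v} g Y ≫ U.map X Y =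
      U.map X' Y ≫ eHomWhiskerRight SSet.{v} (umap U g) (U.obj Y) := by
  rw [eHomWhiskerRight, eHomWhiskerRight, eHomEquiv_umap]
  simp only [Category.assoc, MonoidalCategory.comp_whiskerRight, U.map_comp]
  rw [MonoidalCategory.leftUnitor_inv_naturality_assoc, MonoidalCategory.tensorHom_def_assoc,
    MonoidalCategory.whisker_exchange_assoc, MonoidalCategory.whisker_exchange_assoc]

lemma whiskerRight_map_assoc (U : EnrichedFunctor SSet.{v} C D) {X X' : C} (g : X ⟶ X') (Y : C)
    {Z : SSet.{v}} (h : (U.obj X ⟶[SSet.{v}] U.obj Y) ⟶ Z) :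
    eHomWhiskerRight SSet.{v} g Y ≫ U.map X Y ≫ h =
      U.map X' Y ≫ eHomWhiskerRight SSet.{v} (umap U g) (U.obj Y) ≫ h := by
  rw [← Category.assoc, whiskerRight_map, Category.assoc]

lemma constMap_map (U : EnrichedFunctor SSet.{v} C D) (K : SSet.{v}) {X Y : C} (f : X ⟶ Y) :
    constMap K f ≫ U.map X Y = constMap K (umap U f) := by
  rw [constMap, constMap, eHomEquiv_umap, Category.assoc]

end EnrichedBasics

/-! ### The enriched hom-isomorphism of a simplicial adjunction -/

namespace SimplicialAdjunction

variable {C : Type u₁} [Category.{v} C] [SimplicialCategory C]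
  {D : Type u₂} [Category.{v} D] [SimplicialCategory D]
  {L : EnrichedFunctor SSet.{v} C D} {R : EnrichedFunctor SSet.{v} D C}
  (a : SimplicialAdjunction L R)

/-- The unit of a simplicial adjunction. -/
def η (X : C) : X ⟶ R.obj (L.obj X) := a.adj.unit.app X

/-- The counit of a simplicial adjunction. -/
def ε (Y : D) : L.obj (R.obj Y) ⟶ Y := a.adj.counit.app Y

lemma η_naturality {X X' : C} (f : X ⟶ X') : f ≫ a.η X' = a.η X ≫ umap R (umap L f) :=
  a.adj.unit.naturality f

lemma η_naturality_assoc {X X' Z : C} (f : X ⟶ X') (h : R.obj (L.obj X') ⟶ Z) :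
    f ≫ a.η X' ≫ h = a.η X ≫ umap R (umap L f) ≫ h := by
  rw [← Category.assoc, η_naturality, Category.assoc]

lemma ε_naturality {Y Y' : D} (f : Y ⟶ Y') : umap L (umap R f) ≫ a.ε Y' = a.ε Y ≫ f :=
  a.adj.counit.naturality f

lemma left_triangle (X : C) : umap L (a.η X) ≫ a.ε (L.obj X) = 𝟙 (L.obj X) :=
  a.adj.left_triangle_components X

lemma left_triangle_assoc (X : C) {Z : D} (h : L.obj X ⟶ Z) :
    umap L (a.η X) ≫ a.ε (L.obj X) ≫ h = h := by
  rw [← Category.assoc, left_triangle, Category.id_comp]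

lemma right_triangle (Y : D) : a.η (R.obj Y) ≫ umap R (a.ε Y) = 𝟙 (R.obj Y) :=
  a.adj.right_triangle_components Y

lemma right_triangle_assoc (Y : D) {Z : C} (h : R.obj Y ⟶ Z) :
    a.η (R.obj Y) ≫ umap R (a.ε Y) ≫ h = h := by
  rw [← Category.assoc, right_triangle, Category.id_comp]

/-- The isomorphism `Map(L X, Y) ≅ Map(X, R Y)` of a simplicial adjunction. -/
def homIso (X : C) (Y : D) : (L.obj X ⟶[SSet.{v}] Y) ≅ (X ⟶[SSet.{v}] R.obj Y) where
  hom := R.map _ _ ≫ eHomWhiskerRight SSet.{v} (a.η X) (R.obj Y)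
  inv := L.map _ _ ≫ eHomWhiskerLeft SSet.{v} (L.obj X) (a.ε Y)
  hom_inv_id := by
    have h := a.counit_natural (L.obj X) Y
    change R.map _ _ ≫ L.map (R.obj (L.obj X)) (R.obj Y) ≫ eHomWhiskerLeft SSet.{v} _ (a.ε Y) =
      eHomWhiskerRight SSet.{v} (a.ε (L.obj X)) Y at h
    -- Simplicial naturality of the counit turns `R` followed by `L` into precomposition with the
    -- counit; a triangle identity then remains.
    rw [Category.assoc, whiskerRight_map_assoc, ← eHom_whisker_exchange, reassoc_of% h,
      ← eHomWhiskerRight_comp, left_triangle, eHomWhiskerRight_id]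
  inv_hom_id := by
    have h := a.unit_natural X (R.obj Y)
    change eHomWhiskerLeft SSet.{v} X (a.η (R.obj Y)) =
      L.map _ _ ≫ R.map _ _ ≫ eHomWhiskerRight SSet.{v} (a.η X) _ at h
    rw [Category.assoc, whiskerLeft_map_assoc, eHom_whisker_exchange, ← Category.assoc (R.map _ _),
      ← Category.assoc (L.map _ _), ← h, ← eHomWhiskerLeft_comp, right_triangle,
      eHomWhiskerLeft_id]

lemma whiskerLeft_homIso_hom (X : C) {Y Y' : D} (g : Y ⟶ Y') :
    eHomWhiskerLeft SSet.{v} (L.obj X) g ≫ (a.homIso X Y').hom =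
      (a.homIso X Y).hom ≫ eHomWhiskerLeft SSet.{v} X (umap R g) := by
  simp only [homIso, Category.assoc]
  rw [whiskerLeft_map_assoc, eHom_whisker_exchange]

lemma whiskerLeft_homIso_inv (X : C) {Y Y' : D} (g : Y ⟶ Y') :
    eHomWhiskerLeft SSet.{v} X (umap R g) ≫ (a.homIso X Y').inv =
      (a.homIso X Y).inv ≫ eHomWhiskerLeft SSet.{v} (L.obj X) g := by
  rw [Iso.comp_inv_eq, Category.assoc, whiskerLeft_homIso_hom, Iso.inv_hom_id_assoc]

lemma whiskerRight_homIso_hom {X X' : C} (f : X ⟶ X') (Y : D) :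
    eHomWhiskerRight SSet.{v} (umap L f) Y ≫ (a.homIso X Y).hom =
      (a.homIso X' Y).hom ≫ eHomWhiskerRight SSet.{v} f (R.obj Y) := by
  simp only [homIso, Category.assoc]
  rw [whiskerRight_map_assoc, ← eHomWhiskerRight_comp, ← η_naturality, eHomWhiskerRight_comp]

lemma whiskerRight_homIso_inv {X X' : C} (f : X ⟶ X') (Y : D) :
    eHomWhiskerRight SSet.{v} f (R.obj Y) ≫ (a.homIso X Y).inv =
      (a.homIso X' Y).inv ≫ eHomWhiskerRight SSet.{v} (umap L f) Y := by
  rw [Iso.comp_inv_eq, Category.assoc, whiskerRight_homIso_hom, Iso.inv_hom_id_assoc]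

/-- Naturality in the second variable for whole families of maps, not only for single morphisms. The
universal map of a totalization is such a family, so this is what makes the right adjoint preserve
totalizations. -/
lemma eComp_homIso_hom (X : C) (Y Z : D) :
    eComp SSet.{v} (L.obj X) Y Z ≫ (a.homIso X Z).hom =
      ((a.homIso X Y).hom ⊗ₘ R.map Y Z) ≫ eComp SSet.{v} X (R.obj Y) (R.obj Z) := by
  simp only [homIso]
  rw [R.map_comp_assoc, eComp_eHomWhiskerRight, ← MonoidalCategory.tensorHom_id,
    MonoidalCategory.tensorHom_comp_tensorHom_assoc, Category.comp_id]

end SimplicialAdjunction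

/-! ### Copowers, and the enriched universal property of pullbacks -/

section Copower

variable {C : Type u₁} [Category.{v} C] [SimplicialCategory C]

/-- Take the parameter simplicial set to be the unit, whose maps into a simplicial hom are the
morphisms of the underlying category. -/
lemma IsCopower.existsUnique_hom {K : SSet.{v}} {X T : C} {ι : K ⟶ (X ⟶[SSet.{v}] T)}
    (h : IsCopower K X T ι) (Y : C) (s : K ⟶ (X ⟶[SSet.{v}] Y)) :
    ∃! f : T ⟶ Y, s = ι ≫ eHomWhiskerLeft SSet.{v} X f := by
  obtain ⟨k, hk, hu⟩ := h Y (𝟙_ SSet.{v}) ((ρ_ _).hom ≫ s)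
  have key (k : 𝟙_ SSet.{v} ⟶ (T ⟶[SSet.{v}] Y)) :
      ((ρ_ _).hom ≫ s = (ι ⊗ₘ k) ≫ eComp SSet.{v} X T Y) ↔
        s = ι ≫ eHomWhiskerLeft SSet.{v} X ((eHomEquiv SSet.{v}).symm k) := by
    rw [eHomWhiskerLeft, Equiv.apply_symm_apply,
      MonoidalCategory.rightUnitor_inv_naturality_assoc,
      ← MonoidalCategory.tensorHom_def_assoc, Iso.eq_inv_comp]
  refine ⟨(eHomEquiv SSet.{v}).symm k, (key k).1 hk, fun f hf ↦ ?_⟩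
  rw [Equiv.eq_symm_apply]
  refine hu _ ((key _).2 ?_)
  rw [Equiv.symm_apply_apply]
  exact hf

variable (C) in
/-- The existence of all copowers by simplicial sets. -/
def HasCopowers : Prop := ∀ (K : SSet.{v}) (X : C),
    ∃ (T : C) (ι : K ⟶ (X ⟶[SSet.{v}] T)), IsCopower K X T ι

lemma hasCopowers_of_simplicialModelCategory [ModelCategory C] [SimplicialModelCategory C] :
    HasCopowers C := SimplicialModelCategory.exists_copower

variable (hC : HasCopowers C)

/-- A chosen copower. -/
def copower (K : SSet.{v}) (X : C) : C := (hC K X).choose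

/-- The universal map of the chosen copower. -/
def copowerι (K : SSet.{v}) (X : C) : K ⟶ (X ⟶[SSet.{v}] copower hC K X) :=
  (hC K X).choose_spec.choose

lemma isCopower_copower (K : SSet.{v}) (X : C) :
    IsCopower K X (copower hC K X) (copowerι hC K X) :=
  (hC K X).choose_spec.choose_spec

/-- Maps out of a copower. -/
def copowerEquiv (K : SSet.{v}) (X Y : C) :
    (copower hC K X ⟶ Y) ≃ (K ⟶ (X ⟶[SSet.{v}] Y)) :=
  Equiv.ofBijective (fun f ↦ copowerι hC K X ≫ eHomWhiskerLeft SSet.{v} X f) (by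
    constructor
    · intro f g h
      exact ((isCopower_copower hC K X).existsUnique_hom Y _).unique rfl h
    · intro s
      obtain ⟨f, hf, -⟩ := (isCopower_copower hC K X).existsUnique_hom Y s
      exact ⟨f, hf.symm⟩)

lemma copowerEquiv_apply {K : SSet.{v}} {X Y : C} (f : copower hC K X ⟶ Y) :
    copowerEquiv hC K X Y f = copowerι hC K X ≫ eHomWhiskerLeft SSet.{v} X f := rfl

lemma copowerEquiv_comp {K : SSet.{v}} {X Y Y' : C} (f : copower hC K X ⟶ Y) (g : Y ⟶ Y') :
    copowerEquiv hC K X Y' (f ≫ g) =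
      copowerEquiv hC K X Y f ≫ eHomWhiskerLeft SSet.{v} X g := by
  rw [copowerEquiv_apply, copowerEquiv_apply, eHomWhiskerLeft_comp, Category.assoc]

lemma copowerEquiv_symm_comp {K : SSet.{v}} {X Y Y' : C} (s : K ⟶ (X ⟶[SSet.{v}] Y))
    (g : Y ⟶ Y') :
    (copowerEquiv hC K X Y).symm s ≫ g =
      (copowerEquiv hC K X Y').symm (s ≫ eHomWhiskerLeft SSet.{v} X g) := by
  rw [Equiv.eq_symm_apply, copowerEquiv_comp, Equiv.apply_symm_apply]

/-- The functoriality of copowers in both variables. -/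
def copowerMap {K K' : SSet.{v}} (j : K ⟶ K') {X X' : C} (i : X ⟶ X') :
    copower hC K X ⟶ copower hC K' X' :=
  (copowerEquiv hC K X _).symm
    (j ≫ copowerι hC K' X' ≫ eHomWhiskerRight SSet.{v} i (copower hC K' X'))

lemma copowerEquiv_map_comp {K K' : SSet.{v}} (j : K ⟶ K') {X X' Y : C} (i : X ⟶ X')
    (f : copower hC K' X' ⟶ Y) :
    copowerEquiv hC K X Y (copowerMap hC j i ≫ f) =
      j ≫ copowerEquiv hC K' X' Y f ≫ eHomWhiskerRight SSet.{v} i Y := by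
  rw [copowerEquiv_comp, copowerMap, Equiv.apply_symm_apply, copowerEquiv_apply, Category.assoc,
    Category.assoc, Category.assoc, eHom_whisker_exchange]

lemma copowerMap_comp_symm {K K' : SSet.{v}} (j : K ⟶ K') {X X' Y : C} (i : X ⟶ X')
    (s : K' ⟶ (X' ⟶[SSet.{v}] Y)) :
    copowerMap hC j i ≫ (copowerEquiv hC K' X' Y).symm s =
      (copowerEquiv hC K X Y).symm (j ≫ s ≫ eHomWhiskerRight SSet.{v} i Y) := by
  rw [Equiv.eq_symm_apply, copowerEquiv_map_comp, Equiv.apply_symm_apply]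

include hC in
/-- Pullbacks in a simplicial category with copowers are simplicially enriched. -/
lemma IsPullback.eHom_exists {P X Y Z : C} {fst : P ⟶ X} {snd : P ⟶ Y} {f : X ⟶ Z} {g : Y ⟶ Z}
    (h : IsPullback fst snd f g) (A : C) {K : SSet.{v}} (s : K ⟶ (A ⟶[SSet.{v}] X))
    (t : K ⟶ (A ⟶[SSet.{v}] Y))
    (w : s ≫ eHomWhiskerLeft SSet.{v} A f = t ≫ eHomWhiskerLeft SSet.{v} A g) :
    ∃ k : K ⟶ (A ⟶[SSet.{v}] P), k ≫ eHomWhiskerLeft SSet.{v} A fst = s ∧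
      k ≫ eHomWhiskerLeft SSet.{v} A snd = t := by
  have e : (copowerEquiv hC K A X).symm s ≫ f = (copowerEquiv hC K A Y).symm t ≫ g := by
    rw [copowerEquiv_symm_comp, copowerEquiv_symm_comp, w]
  refine ⟨copowerEquiv hC K A P (h.lift _ _ e), ?_, ?_⟩
  · rw [← copowerEquiv_comp, h.lift_fst, Equiv.apply_symm_apply]
  · rw [← copowerEquiv_comp, h.lift_snd, Equiv.apply_symm_apply]

include hC in
lemma IsPullback.eHom_ext {P X Y Z : C} {fst : P ⟶ X} {snd : P ⟶ Y} {f : X ⟶ Z} {g : Y ⟶ Z}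
    (h : IsPullback fst snd f g) {A : C} {K : SSet.{v}} {k l : K ⟶ (A ⟶[SSet.{v}] P)}
    (h₁ : k ≫ eHomWhiskerLeft SSet.{v} A fst = l ≫ eHomWhiskerLeft SSet.{v} A fst)
    (h₂ : k ≫ eHomWhiskerLeft SSet.{v} A snd = l ≫ eHomWhiskerLeft SSet.{v} A snd) : k = l := by
  apply (copowerEquiv hC K A P).symm.injective
  apply h.hom_ext
  · rw [copowerEquiv_symm_comp, copowerEquiv_symm_comp, h₁]
  · rw [copowerEquiv_symm_comp, copowerEquiv_symm_comp, h₂]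

end Copower

/-- Evaluation at the point `e` recovers the morphism; without a point, as for empty `K`, the claim
can fail. -/
lemma constMap_injective {C : Type u₁} [Category.{v} C] [SimplicialCategory C]
    {K : SSet.{v}} (e : 𝟙_ SSet.{v} ⟶ K) {X Y : C} {f g : X ⟶ Y}
    (h : constMap K f = constMap K g) : f = g := by
  apply (eHomEquiv SSet.{v}).injective
  have h' := congrArg (e ≫ ·) h
  simp only [constMap, ← Category.assoc] at h'
  rwa [SemiCartesianMonoidalCategory.toUnit_unique (e ≫ _) (𝟙 _), Category.id_comp,
    Category.id_comp] at h'

/-! ### Strong deformation retracts that are cofibrations are acyclic -/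

section Lifting

lemma trivialCofibrations_of_lifting {N : Type u₂} [Category.{v} N] [ModelCategory N]
    {A B : N} (i : A ⟶ B)
    (h : ∀ ⦃X Y : N⦄ (p : X ⟶ Y), fibrations N p → HasLiftingProperty i p) :
    trivialCofibrations N i := by
  rw [← MorphismProperty.llp_eq_of_wfs (trivialCofibrations N) (fibrations N)]
  exact fun X Y p hp ↦ h p hp

variable {N : Type u₂} [Category.{v} N] [SimplicialCategory N]
  [ModelCategory N]

/-- Kan fibrations lift edges along their final vertex. -/
lemma exists_lift_of_J_rlp {X Y : SSet.{v}} {p : X ⟶ Y}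
    (hp : SSet.modelCategoryQuillen.J.rlp p) (e : Δ[1] ⟶ Y) (x : Δ[0] ⟶ X)
    (hx : x ≫ p = SSet.stdSimplex.δ (0 : Fin 2) ≫ e) :
    ∃ l : Δ[1] ⟶ X, SSet.stdSimplex.δ (0 : Fin 2) ≫ l = x ∧ l ≫ p = e := by
  open SSet.modelCategoryQuillen in
  have : Fibration p := by rwa [fibration_iff]
  have hc : SSet.horn.IsCompatible (i := (1 : Fin 2)) (X := X)
      (fun (_ : Fin 2) (_ : _ ≠ (1 : Fin 2)) ↦ x) := trivial
  obtain ⟨l, hl, hl'⟩ := hc.exists_lift p e (fun j hj ↦ by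
    match j, hj with
    | 0, _ => exact hx
    | 1, h => exact (h rfl).elim)
  exact ⟨l, hl 0 (by decide), hl'⟩

/-- The pair consisting of the constant edge at `f` and of `H` followed by `g` is an edge in the
target of `pullbackHom i p`. Its final vertex lifts to `r ≫ f`, so the whole edge lifts by SM7. -/
lemma IsStrongDeformationRetract.hasLiftingProperty [SimplicialModelCategory N]
    {A B X Y : N} {i : A ⟶ B} (h : IsStrongDeformationRetract i) (hi : cofibrations N i)
    {p : X ⟶ Y} (hp : fibrations N p) : HasLiftingProperty i p := by
  obtain ⟨r, hr, H, h0, h1, hc⟩ := h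
  refine ⟨fun {f g} sq ↦ ?_⟩
  have hK := SimplicialModelCategory.sm7 i p hi hp
  obtain ⟨l, hl, hl'⟩ := exists_lift_of_J_rlp hK
    (pullback.lift (constMap Δ[1] f) (H ≫ eHomWhiskerLeft SSet.{v} B g) (by
      rw [Category.assoc, eHom_whisker_exchange, ← Category.assoc, hc,
        Totalization.constMap_comp_whiskerLeft, Totalization.constMap_comp_whiskerLeft, sq.w]))
    (constMap Δ[0] (r ≫ f)) (by
      apply pullback.hom_ext
      · simp only [pullbackHom, Category.assoc, pullback.lift_fst]
        rw [Totalization.constMap_comp_whiskerRight, reassoc_of% hr]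
        exact (Totalization.comp_constMap _ _).symm
      · simp only [pullbackHom, Category.assoc, pullback.lift_snd]
        rw [Totalization.constMap_comp_whiskerLeft, ← Category.assoc]
        refine Eq.trans ?_ (congrArg (· ≫ _) h1.symm)
        rw [Totalization.constMap_comp_whiskerLeft, Category.assoc, Category.assoc, sq.w])
  -- The initial vertex of the lifted edge is the diagonal filler: it lies over `(f, g)` because `H`
  -- starts at the identity of `B`.
  obtain ⟨w, hw⟩ := exists_eq_constMap SSet.stdSimplex.isTerminalObj₀
    (SSet.stdSimplex.δ (1 : Fin 2) ≫ l)
  have e1 := congrArg (fun k ↦ SSet.stdSimplex.δ (1 : Fin 2) ≫ k ≫ pullback.fst _ _) hl'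
  have e2 := congrArg (fun k ↦ SSet.stdSimplex.δ (1 : Fin 2) ≫ k ≫ pullback.snd _ _) hl'
  simp only [pullbackHom, Category.assoc, pullback.lift_fst, pullback.lift_snd] at e1 e2
  rw [← Category.assoc, hw] at e1 e2
  rw [Totalization.constMap_comp_whiskerRight, Totalization.comp_constMap] at e1
  have e3 : SSet.stdSimplex.δ (1 : Fin 2) ≫ H = constMap _ (𝟙 B) := h0
  rw [Totalization.constMap_comp_whiskerLeft, reassoc_of% e3,
    Totalization.constMap_comp_whiskerLeft, Category.id_comp] at e2
  exact ⟨⟨w, constMap_injective (SSet.stdSimplex.isTerminalObj₀.from _) e1,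
    constMap_injective (SSet.stdSimplex.isTerminalObj₀.from _) e2⟩⟩

lemma IsStrongDeformationRetract.trivialCofibrations [SimplicialModelCategory N]
    {A B : N} {i : A ⟶ B} (h : IsStrongDeformationRetract i) (hi : cofibrations N i) :
    trivialCofibrations N i :=
  trivialCofibrations_of_lifting i (fun _ _ _ hp ↦ h.hasLiftingProperty hi hp)

end Lifting

/-! ### The adjunction `UF ⊣ UG` and part (a) -/

section Transpose

variable {M : Type u₁} [Category.{v} M] [SimplicialCategory M]
  {N : Type u₂} [Category.{v} N] [SimplicialCategory N]
  {U : EnrichedFunctor SSet.{v} M N} {F G : EnrichedFunctor SSet.{v} N M}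
  (aF : SimplicialAdjunction F U) (aG : SimplicialAdjunction U G)

/-- The transposition for the composite adjunction `U F ⊣ U G`. -/
def transpose (B Z : N) : (B ⟶ U.obj (G.obj Z)) ≃ (U.obj (F.obj B) ⟶ Z) where
  toFun a := umap U (umap F a ≫ aF.ε _) ≫ aG.ε Z
  invFun b := aF.η B ≫ umap U (aG.η _ ≫ umap G b)
  left_inv a := by
    simp only [umap_comp, Category.assoc, ← aG.η_naturality_assoc]
    rw [← aF.η_naturality_assoc, ← umap_comp U (aG.η _), aG.right_triangle, umap_id,
      Category.comp_id, aF.right_triangle, Category.comp_id]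
  right_inv b := by
    have h : umap F (aF.η B ≫ umap U (aG.η _ ≫ umap G b)) ≫ aF.ε _ = aG.η _ ≫ umap G b := by
      rw [umap_comp, Category.assoc, aF.ε_naturality, aF.left_triangle_assoc]
    dsimp only
    rw [h, umap_comp, Category.assoc, aG.ε_naturality, aG.left_triangle_assoc]

/-- The mate relation between unit and counit; it is what matches the pushout corner on one side
with the pullback corner on the other. -/
lemma η_transpose {B Z : N} (a : B ⟶ U.obj (G.obj Z)) :
    aF.η B ≫ transpose aF aG B Z a = a ≫ aG.ε Z := by
  simp only [transpose, Equiv.coe_fn_mk, umap_comp, Category.assoc, ← aF.η_naturality_assoc,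
    aF.right_triangle_assoc]

lemma transpose_comp_left {B B' Z : N} (i : B ⟶ B') (a : B' ⟶ U.obj (G.obj Z)) :
    transpose aF aG B Z (i ≫ a) = umap U (umap F i) ≫ transpose aF aG B' Z a := by
  simp only [transpose, Equiv.coe_fn_mk, umap_comp, Category.assoc]

lemma transpose_comp_right {B Z Z' : N} (a : B ⟶ U.obj (G.obj Z)) (g : Z ⟶ Z') :
    transpose aF aG B Z' (a ≫ umap U (umap G g)) = transpose aF aG B Z a ≫ g := by
  simp only [transpose, Equiv.coe_fn_mk, umap_comp, Category.assoc]
  rw [← umap_comp_assoc U (umap F (umap U _)), aF.ε_naturality, umap_comp_assoc, aG.ε_naturality]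

/-- The Leibniz constructions of the unit of `U F` and the counit of `U G` are adjoint with respect
to lifting properties. -/
lemma hasLiftingProperty_leibniz_iff {A B X Y P Q : N} {i : A ⟶ B} {p : X ⟶ Y}
    {inl : B ⟶ P} {inr : U.obj (F.obj A) ⟶ P} (hP : IsPushout i (aF.η A) inl inr)
    {d : P ⟶ U.obj (F.obj B)} (hdl : inl ≫ d = aF.η B) (hdr : inr ≫ d = umap U (umap F i))
    {fst : Q ⟶ U.obj (G.obj Y)} {snd : Q ⟶ X} (hQ : IsPullback fst snd (aG.ε Y) p)
    {e : U.obj (G.obj X) ⟶ Q} (hel : e ≫ fst = umap U (umap G p)) (her : e ≫ snd = aG.ε X) :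
    HasLiftingProperty d p ↔ HasLiftingProperty i e := by
  constructor
  · intro _
    refine ⟨fun {f g} sq ↦ ?_⟩
    -- A map to the pullback has a component in `X`, which is kept, and one in `U G Y`, which is
    -- transposed. The former and the transpose of `f` agree on `A` by the mate relation, so they
    -- glue along the pushout.
    have sq' : CommSq (hP.desc (g ≫ snd) (transpose aF aG A X f) (by
        rw [η_transpose, ← her, ← reassoc_of% sq.w])) d p
        (transpose aF aG B Y (g ≫ fst)) := ⟨by
      apply hP.hom_ext
      · rw [hP.inl_desc_assoc, reassoc_of% hdl, η_transpose, Category.assoc, Category.assoc, hQ.w]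
      · rw [hP.inr_desc_assoc, reassoc_of% hdr, ← transpose_comp_left, ← transpose_comp_right,
          ← hel, reassoc_of% sq.w]⟩
    obtain ⟨l, hl₁, hl₂⟩ : ∃ l, d ≫ l = hP.desc _ _ _ ∧ l ≫ p = _ :=
      ⟨sq'.lift, sq'.fac_left, sq'.fac_right⟩
    refine ⟨⟨(transpose aF aG B X).symm l, ?_, ?_⟩⟩
    · apply (transpose aF aG A X).injective
      rw [transpose_comp_left, Equiv.apply_symm_apply, ← hdr, Category.assoc, hl₁,
        hP.inr_desc]
    · apply hQ.hom_ext
      · apply (transpose aF aG B Y).injective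
        rw [Category.assoc, hel, transpose_comp_right, Equiv.apply_symm_apply, hl₂]
      · rw [Category.assoc, her, ← η_transpose aF aG, Equiv.apply_symm_apply, ← hdl,
          Category.assoc, hl₁, hP.inl_desc]
  · intro _
    refine ⟨fun {f g} sq ↦ ?_⟩
    have sq' : CommSq ((transpose aF aG A X).symm (inr ≫ f)) i e
        (hQ.lift ((transpose aF aG B Y).symm g) (inl ≫ f) (by
          rw [← η_transpose aF aG, Equiv.apply_symm_apply, ← hdl, Category.assoc, Category.assoc,
            sq.w])) := ⟨by
      apply hQ.hom_ext
      · apply (transpose aF aG A Y).injective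
        rw [Category.assoc, Category.assoc, hel, hQ.lift_fst, transpose_comp_right,
          transpose_comp_left, Equiv.apply_symm_apply, Equiv.apply_symm_apply, ← hdr,
          Category.assoc, Category.assoc, sq.w]
      · rw [Category.assoc, Category.assoc, her, hQ.lift_snd, ← η_transpose aF aG,
          Equiv.apply_symm_apply, hP.w_assoc]⟩
    obtain ⟨l, hl₁, hl₂⟩ : ∃ l, i ≫ l = _ ∧ l ≫ e = hQ.lift _ _ _ :=
      ⟨sq'.lift, sq'.fac_left, sq'.fac_right⟩
    refine ⟨⟨transpose aF aG B X l, ?_, ?_⟩⟩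
    · apply hP.hom_ext
      · rw [reassoc_of% hdl, η_transpose, ← her, ← Category.assoc, hl₂, hQ.lift_snd]
      · rw [reassoc_of% hdr, ← transpose_comp_left, hl₁, Equiv.apply_symm_apply]
    · rw [← transpose_comp_right, ← hel, ← Category.assoc, hl₂, hQ.lift_fst,
        Equiv.apply_symm_apply]

variable [ModelCategory N]

lemma hasLiftingProperty_unit_iff {A B X Y : N} (i : A ⟶ B) (p : X ⟶ Y) :
    HasLiftingProperty (pushout.desc (aF.adj.toMonad.η.app B) (aF.adj.toMonad.map i)
      (aF.adj.toMonad.η.naturality i) :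
        pushout ((𝟭 N).map i) (aF.adj.toMonad.η.app A) ⟶ aF.adj.toMonad.obj B) p ↔
    HasLiftingProperty i (pullback.lift (aG.adj.toComonad.map p) (aG.adj.toComonad.ε.app X)
      (aG.adj.toComonad.ε.naturality p) :
        aG.adj.toComonad.obj X ⟶ pullback (aG.adj.toComonad.ε.app Y) ((𝟭 N).map p)) :=
  hasLiftingProperty_leibniz_iff aF aG (IsPushout.of_hasPushout _ _) (pushout.inl_desc _ _ _)
    (pushout.inr_desc _ _ _) (IsPullback.of_hasPullback _ _) (pullback.lift_fst _ _ _)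
    (pullback.lift_snd _ _ _)

theorem quillenCounitFibrant_iff_quillenUnitCofibrant :
    QuillenCounitFibrant aG.adj.toComonad ↔ QuillenUnitCofibrant aF.adj.toMonad := by
  have c : cofibrations N = (trivialFibrations N).llp :=
    (MorphismProperty.llp_eq_of_wfs (cofibrations N) (trivialFibrations N)).symm
  have tc : trivialCofibrations N = (fibrations N).llp :=
    (MorphismProperty.llp_eq_of_wfs (trivialCofibrations N) (fibrations N)).symm
  have f : fibrations N = (trivialCofibrations N).rlp :=
    (MorphismProperty.rlp_eq_of_wfs (trivialCofibrations N) (fibrations N)).symm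
  have tf : trivialFibrations N = (cofibrations N).rlp :=
    (MorphismProperty.rlp_eq_of_wfs (cofibrations N) (trivialFibrations N)).symm
  have lift₁ {A B X Y : N} {i : A ⟶ B} {p : X ⟶ Y} (hi : cofibrations N i)
      (hp : trivialFibrations N p) : HasLiftingProperty i p := by
    rw [c] at hi; exact hi _ hp
  have lift₂ {A B X Y : N} {i : A ⟶ B} {p : X ⟶ Y} (hi : trivialCofibrations N i)
      (hp : fibrations N p) : HasLiftingProperty i p := by
    rw [tc] at hi; exact hi _ hp
  constructor
  · intro h A B i hi
    refine ⟨?_, fun hw ↦ (?_ : trivialCofibrations N _).2⟩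
    · rw [c]
      intro X Y p hp
      exact (hasLiftingProperty_unit_iff aF aG i p).2 (lift₁ hi ⟨(h p hp.1).1, (h p hp.1).2 hp.2⟩)
    · rw [tc]
      intro X Y p hp
      exact (hasLiftingProperty_unit_iff aF aG i p).2 (lift₂ ⟨hi, hw⟩ (h p hp).1)
  · intro h X Y p hp
    refine ⟨?_, fun hw ↦ (?_ : trivialFibrations N _).2⟩
    · rw [f]
      intro A B i hi
      exact (hasLiftingProperty_unit_iff aF aG i p).1 (lift₂ ⟨(h i hi.1).1, (h i hi.1).2 hi.2⟩ hp)
    · rw [tf]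
      intro A B i hi
      exact (hasLiftingProperty_unit_iff aF aG i p).1 (lift₁ (h i hi).1 ⟨hp, hw⟩)

/-- The pushout-corner map of a trivial cofibration and the unit of `U F`. -/
lemma trivialCofibrations_unit_corner (h : QuillenUnitCofibrant aF.adj.toMonad)
    {A B : N} {i : A ⟶ B} (hi : trivialCofibrations N i) :
    ∃ (P : N) (inl : B ⟶ P) (inr : U.obj (F.obj A) ⟶ P) (d : P ⟶ U.obj (F.obj B)),
      IsPushout i (aF.η A) inl inr ∧ inl ≫ d = aF.η B ∧ inr ≫ d = umap U (umap F i) ∧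
        trivialCofibrations N d :=
  ⟨_, _, _, _, IsPushout.of_hasPushout ((𝟭 N).map i) (aF.adj.toMonad.η.app A),
    pushout.inl_desc _ _ (aF.adj.toMonad.η.naturality i), pushout.inr_desc _ _ _,
    (h i hi.1).1, (h i hi.1).2 hi.2⟩

/-- `UF i` is a cobase change of `i` followed by the corner map of the unit, and both are acyclic
cofibrations. -/
lemma trivialCofibrations_umap_umap (h : QuillenUnitCofibrant aF.adj.toMonad)
    {A B : N} {i : A ⟶ B} (hi : trivialCofibrations N i) :
    trivialCofibrations N (umap U (umap F i)) := by
  obtain ⟨P, inl, inr, d, hP, -, hdr, hd⟩ := trivialCofibrations_unit_corner aF h hi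
  rw [← hdr]
  exact (trivialCofibrations N).comp_mem _ _ (MorphismProperty.of_isPushout hP.flip hi) hd

end Transpose

/-! ### Lifting against the relative matching maps in `N` -/

section Matching

variable {M : Type u₁} [Category.{v} M] [SimplicialCategory M]
  {N : Type u₂} [Category.{v} N] [SimplicialCategory N]
  {U : EnrichedFunctor SSet.{v} M N} {F G : EnrichedFunctor SSet.{v} N M}
  (aF : SimplicialAdjunction F U) (aG : SimplicialAdjunction U G)

/-- The object `U (G U)^n X = (U G)^n U X`. -/
def V (X : M) (n : ℕ) : N := U.obj (iter aG.adj.toMonad X n)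

/-- The functor `U G` applied to a map between iterates. -/
def vmap {X Y : M} {m n : ℕ} (g : V aG X m ⟶ V aG Y n) : V aG X (m + 1) ⟶ V aG Y (n + 1) :=
  umap U (umap G g)

/-- The counit of `U G` at an iterate. -/
def vε (X : M) (n : ℕ) : V aG X (n + 1) ⟶ V aG X n := aG.ε _

/-- The image under `U` of the map of iterates induced by `f`. -/
def vf {X Y : M} (f : X ⟶ Y) (n : ℕ) : V aG X n ⟶ V aG Y n :=
  umap U (iterHom aG.adj.toMonad f n)

lemma vf_succ {X Y : M} (f : X ⟶ Y) (n : ℕ) : vf aG f (n + 1) = vmap aG (vf aG f n) := rfl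

lemma vε_naturality {X Y : M} {m n : ℕ} (g : V aG X m ⟶ V aG Y n) :
    vmap aG g ≫ vε aG Y n = vε aG X m ≫ g :=
  aG.ε_naturality g

/-- Transposition of maps into iterates. -/
def vtr (B : N) (X : M) (n : ℕ) : (B ⟶ V aG X (n + 1)) ≃ (U.obj (F.obj B) ⟶ V aG X n) :=
  transpose aF aG B (V aG X n)

lemma η_vtr {B : N} {X : M} {n : ℕ} (a : B ⟶ V aG X (n + 1)) :
    aF.η B ≫ vtr aF aG B X n a = a ≫ vε aG X n :=
  η_transpose aF aG a

lemma vtr_comp_left {B B' : N} {X : M} {n : ℕ} (i : B ⟶ B') (a : B' ⟶ V aG X (n + 1)) :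
    vtr aF aG B X n (i ≫ a) = umap U (umap F i) ≫ vtr aF aG B' X n a :=
  transpose_comp_left aF aG i a

lemma vtr_comp_vmap {B : N} {X Y : M} {m n : ℕ} (a : B ⟶ V aG X (m + 1))
    (g : V aG X m ⟶ V aG Y n) :
    vtr aF aG B Y n (a ≫ vmap aG g) = vtr aF aG B X m a ≫ g :=
  transpose_comp_right aF aG a g

/-- The counit applied to the `j`-th of the `n + 1` copies of `U G`, counted from the innermost
one. -/
def vcod (X : M) (n j : ℕ) : V aG X (n + 1) ⟶ V aG X n :=
  match n with
  | 0 => vε aG X 0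
  | n + 1 => if j = n + 1 then vε aG X (n + 1) else vmap aG (vcod X n j)

lemma vcod_last (X : M) (n : ℕ) : vcod aG X n n = vε aG X n := by
  cases n with
  | zero => rfl
  | succ n => exact if_pos rfl

lemma vcod_of_le (X : M) {n j : ℕ} (h : j ≤ n) : vcod aG X (n + 1) j = vmap aG (vcod aG X n j) :=
  if_neg (by omega)

/-- The compatibility of a family of maps into `(U G)^n U X`, for it to come from
a map into `(U G)^(n + 1) U X`. -/
def MatchingCompatible {B : N} {X : M} {n : ℕ} (x : ℕ → (B ⟶ V aG X n)) : Prop :=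
  match n, x with
  | 0, _ => True
  | n + 1, x => ∀ i j, i ≤ j → j ≤ n → x i ≫ vcod aG X n j = x (j + 1) ≫ vcod aG X n i

variable [ModelCategory N]

/-- The family `x` prescribes all codegeneracies of the lift. Transposing along `UF ⊣ UG` strips the
outermost `UG`. The outermost counit becomes restriction along the unit of `UF`, hence a boundary
condition on the pushout `P`. The other codegeneracies are `UG` of those one level below, hence
again matching data. So the problem for `i` becomes the same problem for the corner map `d`, one
level lower, ending with lifting against `U f`. The acyclic cofibration must vary in the induction.
-/
lemma exists_matching_lift (hT : QuillenUnitCofibrant aF.adj.toMonad) {X Y : M} (f : X ⟶ Y)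
    (hf : fibrations N (vf aG f 0)) (n : ℕ) {A B : N} {i : A ⟶ B} (hi : trivialCofibrations N i)
    (a : A ⟶ V aG X (n + 1)) (b : B ⟶ V aG Y (n + 1)) (x : ℕ → (B ⟶ V aG X n))
    (hab : a ≫ vf aG f (n + 1) = i ≫ b) (hax : ∀ j ≤ n, i ≫ x j = a ≫ vcod aG X n j)
    (hxb : ∀ j ≤ n, x j ≫ vf aG f n = b ≫ vcod aG Y n j) (hx : MatchingCompatible aG x) :
    ∃ w : B ⟶ V aG X (n + 1), i ≫ w = a ∧ w ≫ vf aG f (n + 1) = b ∧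
      ∀ j ≤ n, w ≫ vcod aG X n j = x j := by
  induction n generalizing A B with
  | zero =>
    obtain ⟨P, inl, inr, d, hP, hdl, hdr, hd⟩ := trivialCofibrations_unit_corner aF hT hi
    have sq : CommSq (hP.desc (x 0) (vtr aF aG A X 0 a) (by
      rw [η_vtr, hax 0 le_rfl, vcod_last])) d (vf aG f 0) (vtr aF aG B Y 0 b) := ⟨by
        apply hP.hom_ext
        · rw [hP.inl_desc_assoc, reassoc_of% hdl, η_vtr, hxb 0 le_rfl, vcod_last]
        · rw [hP.inr_desc_assoc, reassoc_of% hdr, ← vtr_comp_left, ← hab, vf_succ, vtr_comp_vmap]⟩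
    have : HasLiftingProperty d (vf aG f 0) := by
      rw [← MorphismProperty.llp_eq_of_wfs (trivialCofibrations N) (fibrations N)] at hd
      exact hd _ hf
    obtain ⟨w, hw₁, hw₂⟩ : ∃ l, d ≫ l = hP.desc _ _ _ ∧ l ≫ vf aG f 0 = _ :=
      ⟨sq.lift, sq.fac_left, sq.fac_right⟩
    refine ⟨(vtr aF aG B X 0).symm w, ?_, ?_, fun j hj ↦ ?_⟩
    · apply (vtr aF aG A X 0).injective
      rw [vtr_comp_left, Equiv.apply_symm_apply, ← hdr, Category.assoc, hw₁, hP.inr_desc]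
    · apply (vtr aF aG B Y 0).injective
      rw [vf_succ, vtr_comp_vmap, Equiv.apply_symm_apply, hw₂]
    · obtain rfl : j = 0 := by omega
      rw [vcod_last, ← η_vtr aF, Equiv.apply_symm_apply, ← hdl, Category.assoc, hw₁, hP.inl_desc]
  | succ n ih =>
    have hx' : ∀ i j, i ≤ j → j ≤ n → x i ≫ vcod aG X n j = x (j + 1) ≫ vcod aG X n i := hx
    obtain ⟨P, inl, inr, d, hP, hdl, hdr, hd⟩ := trivialCofibrations_unit_corner aF hT hi
    have hca : i ≫ x (n + 1) = aF.η A ≫ vtr aF aG A X (n + 1) a := by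
      rw [η_vtr, hax _ le_rfl, vcod_last]
    -- The last matching component is used as the value on `B ⟶ P`; its compatibility with the
    -- remaining ones is the matching identity for the pairs `(j, n)`.
    obtain ⟨w, hw₁, hw₂, hw₃⟩ := ih hd (hP.desc (x (n + 1)) (vtr aF aG A X (n + 1) a) hca)
      (vtr aF aG B Y (n + 1) b) (fun j ↦ vtr aF aG B X n (x j)) (by
        apply hP.hom_ext
        · rw [hP.inl_desc_assoc, reassoc_of% hdl, η_vtr, hxb _ le_rfl, vcod_last]
        · rw [hP.inr_desc_assoc, reassoc_of% hdr, ← vtr_comp_left, ← hab, vf_succ _ _ (n + 1),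
            vtr_comp_vmap]) (fun j hj ↦ by
        apply hP.hom_ext
        · rw [hP.inl_desc_assoc, reassoc_of% hdl, η_vtr, ← vcod_last, hx' j n hj le_rfl]
        · rw [hP.inr_desc_assoc, reassoc_of% hdr, ← vtr_comp_left, hax _ (by omega),
            vcod_of_le _ _ hj, vtr_comp_vmap]) (fun j hj ↦ by
        rw [← vtr_comp_vmap, ← vf_succ, hxb _ (by omega), vcod_of_le _ _ hj, vtr_comp_vmap]) (by
        cases n with
        | zero => trivial
        | succ n =>
          intro k j hkj hj
          have h := congrArg (vtr aF aG B X n) (hx' k j hkj (by omega))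
          rwa [vcod_of_le _ _ hj, vcod_of_le _ _ (by omega), vtr_comp_vmap, vtr_comp_vmap] at h)
    refine ⟨(vtr aF aG B X (n + 1)).symm w, ?_, ?_, fun j hj ↦ ?_⟩
    · apply (vtr aF aG A X _).injective
      rw [vtr_comp_left, Equiv.apply_symm_apply, ← hdr, Category.assoc, hw₁, hP.inr_desc]
    · apply (vtr aF aG B Y _).injective
      rw [vf_succ, vtr_comp_vmap, Equiv.apply_symm_apply, hw₂]
    · obtain hj | rfl := Nat.le_succ_iff.1 hj
      · apply (vtr aF aG B X _).injective
        rw [vcod_of_le _ _ hj, vtr_comp_vmap, Equiv.apply_symm_apply, hw₃ j hj]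
      · rw [vcod_last, ← η_vtr aF, Equiv.apply_symm_apply, ← hdl, Category.assoc, hw₁, hP.inl_desc]

end Matching

/-! ### Pushout-products with boundary inclusions -/

section PushoutProduct

variable {N : Type u₂} [Category.{v} N] [SimplicialCategory N] [ModelCategory N]
  [SimplicialModelCategory N]

/-- The pushout-product of a trivial cofibration and a boundary inclusion
is a trivial cofibration. -/
lemma exists_trivialCofibration_pushoutProduct {A B : N} {i : A ⟶ B}
    (hi : trivialCofibrations N i) (k : ℕ) (hN : HasCopowers N) :
    ∃ (P : N) (inl : copower hN Δ[k] A ⟶ P) (inr : copower hN (∂Δ[k] : SSet.{v}) B ⟶ P)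
      (d : P ⟶ copower hN Δ[k] B),
      IsPushout (copowerMap hN ∂Δ[k].ι (𝟙 A)) (copowerMap hN (𝟙 (∂Δ[k] : SSet.{v})) i) inl inr ∧
      inl ≫ d = copowerMap hN (𝟙 _) i ∧ inr ≫ d = copowerMap hN ∂Δ[k].ι (𝟙 B) ∧
      trivialCofibrations N d := by
  have hw : copowerMap hN ∂Δ[k].ι (𝟙 A) ≫ copowerMap hN (𝟙 _) i =
      copowerMap hN (𝟙 (∂Δ[k] : SSet.{v})) i ≫ copowerMap hN ∂Δ[k].ι (𝟙 B) := by
    apply (copowerEquiv hN _ _ _).injective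
    rw [copowerEquiv_map_comp, copowerEquiv_map_comp, copowerMap, copowerMap,
      Equiv.apply_symm_apply, Equiv.apply_symm_apply]
    simp
  refine ⟨_, _, _, _, IsPushout.of_hasPushout _ _, pushout.inl_desc _ _ hw,
    pushout.inr_desc _ _ _, trivialCofibrations_of_lifting _ (fun X Y p hp ↦ ⟨fun {f g} sq ↦ ?_⟩)⟩
  have w₁ := congrArg (copowerEquiv hN _ _ _) (pushout.inl _ _ ≫= sq.w)
  have w₂ := congrArg (copowerEquiv hN _ _ _) (pushout.inr _ _ ≫= sq.w)
  have w₃ := congrArg (fun t ↦ copowerEquiv hN _ _ _ (t ≫ f)) (pushout.condition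
    (f := copowerMap hN ∂Δ[k].ι (𝟙 A)) (g := copowerMap hN (𝟙 (∂Δ[k] : SSet.{v})) i))
  simp only [Category.assoc, copowerEquiv_map_comp, pushout.inl_desc_assoc,
    pushout.inr_desc_assoc, eHomWhiskerRight_id, Category.comp_id, Category.id_comp] at w₁ w₂ w₃
  rw [← Category.assoc, copowerEquiv_comp] at w₁ w₂
  have hI := SimplicialModelCategory.sm7_acyclic i p hi.1 hp (Or.inl hi.2) _
    (SSet.modelCategoryQuillen.boundary_ι_mem_I k)
  -- Through the copower adjunction, lifting the pushout-product against `p` means lifting the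
  -- boundary inclusion against `pullbackHom i p`, which is the acyclic case of SM7.
  have sq' : CommSq (copowerEquiv hN _ _ _ (pushout.inr _ _ ≫ f)) ∂Δ[k].ι (pullbackHom i p)
      (pullback.lift (copowerEquiv hN _ _ _ (pushout.inl _ _ ≫ f)) (copowerEquiv hN _ _ _ g) w₁) :=
    ⟨by
      apply pullback.hom_ext
      · simp only [pullbackHom, Category.assoc, pullback.lift_fst, w₃]
      · simp only [pullbackHom, Category.assoc, pullback.lift_snd, w₂]⟩
  obtain ⟨l, hl₁, hl₂⟩ : ∃ l, ∂Δ[k].ι ≫ l = _ ∧ l ≫ pullbackHom i p = pullback.lift _ _ _ :=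
    ⟨sq'.lift, sq'.fac_left, sq'.fac_right⟩
  refine ⟨⟨(copowerEquiv hN _ _ _).symm l, ?_, ?_⟩⟩
  · apply pushout.hom_ext
    · apply (copowerEquiv hN _ _ _).injective
      rw [pushout.inl_desc_assoc, copowerEquiv_map_comp, Equiv.apply_symm_apply, Category.id_comp]
      simpa only [pullbackHom, Category.assoc, pullback.lift_fst] using hl₂ =≫ pullback.fst _ _
    · apply (copowerEquiv hN _ _ _).injective
      rw [pushout.inr_desc_assoc, copowerEquiv_map_comp, Equiv.apply_symm_apply,
        eHomWhiskerRight_id, Category.comp_id, hl₁]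
  · rw [copowerEquiv_symm_comp, Equiv.symm_apply_eq]
    simpa only [pullbackHom, Category.assoc, pullback.lift_snd] using hl₂ =≫ pullback.snd _ _

end PushoutProduct

/-! ### Matching lifts for simplices with prescribed boundary -/

section SimplicialMatching

variable {M : Type u₁} [Category.{v} M] [SimplicialCategory M]
  {N : Type u₂} [Category.{v} N] [SimplicialCategory N] [ModelCategory N]
  [SimplicialModelCategory N]
  {U : EnrichedFunctor SSet.{v} M N} {F G : EnrichedFunctor SSet.{v} N M}
  (aF : SimplicialAdjunction F U) (aG : SimplicialAdjunction U G)

/-- Copowers turn simplices of mapping spaces into morphisms, and the data on `A` together with the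
boundary data on `B` into a single map from the pushout-product. This reduces the claim to
`exists_matching_lift`. The condition `hx` quantifies over `n = m + 1`, so that nothing is asked for
`n = 0`. -/
lemma exists_simplicial_matching_lift (hT : QuillenUnitCofibrant aF.adj.toMonad)
    {X Y : M} (f : X ⟶ Y)
    (hf : fibrations N (vf aG f 0)) (n k : ℕ) {A B : N} {i : A ⟶ B} (hi : trivialCofibrations N i)
    (a : Δ[k] ⟶ (A ⟶[SSet.{v}] V aG X (n + 1)))
    (b : Δ[k] ⟶ (B ⟶[SSet.{v}] V aG Y (n + 1)))
    (e : (∂Δ[k] : SSet.{v}) ⟶ (B ⟶[SSet.{v}] V aG X (n + 1)))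
    (x : ℕ → (Δ[k] ⟶ (B ⟶[SSet.{v}] V aG X n)))
    (hae : ∂Δ[k].ι ≫ a = e ≫ eHomWhiskerRight SSet.{v} i _)
    (hab : a ≫ eHomWhiskerLeft SSet.{v} _ (vf aG f (n + 1)) = b ≫ eHomWhiskerRight SSet.{v} i _)
    (heb : e ≫ eHomWhiskerLeft SSet.{v} _ (vf aG f (n + 1)) = ∂Δ[k].ι ≫ b)
    (hax : ∀ j ≤ n, x j ≫ eHomWhiskerRight SSet.{v} i _ =
      a ≫ eHomWhiskerLeft SSet.{v} _ (vcod aG X n j))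
    (hex : ∀ j ≤ n, ∂Δ[k].ι ≫ x j = e ≫ eHomWhiskerLeft SSet.{v} _ (vcod aG X n j))
    (hxb : ∀ j ≤ n, x j ≫ eHomWhiskerLeft SSet.{v} _ (vf aG f n) =
      b ≫ eHomWhiskerLeft SSet.{v} _ (vcod aG Y n j))
    (hx : ∀ m (hm : n = m + 1) p q, p ≤ q → q ≤ m →
      x p ≫ eHomWhiskerLeft SSet.{v} B
        (eqToHom (by rw [hm]) ≫ vcod aG X m q : V aG X n ⟶ V aG X m) =
        x (q + 1) ≫ eHomWhiskerLeft SSet.{v} B (eqToHom (by rw [hm]) ≫ vcod aG X m p)) :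
    ∃ w : Δ[k] ⟶ (B ⟶[SSet.{v}] V aG X (n + 1)), ∂Δ[k].ι ≫ w = e ∧
      w ≫ eHomWhiskerRight SSet.{v} i _ = a ∧
      w ≫ eHomWhiskerLeft SSet.{v} _ (vf aG f (n + 1)) = b ∧
      ∀ j ≤ n, w ≫ eHomWhiskerLeft SSet.{v} _ (vcod aG X n j) = x j := by
  have hN : HasCopowers N := hasCopowers_of_simplicialModelCategory
  obtain ⟨P, inl, inr, d, hP, hdl, hdr, hd⟩ := exists_trivialCofibration_pushoutProduct hi k hN
  obtain ⟨w, hw₁, hw₂, hw₃⟩ := exists_matching_lift aF aG hT f hf n hd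
    (hP.desc ((copowerEquiv hN _ _ _).symm a) ((copowerEquiv hN _ _ _).symm e) (by
      rw [copowerMap_comp_symm, copowerMap_comp_symm, eHomWhiskerRight_id, Category.comp_id, hae,
        Category.id_comp])) ((copowerEquiv hN _ _ _).symm b)
    (fun j ↦ (copowerEquiv hN _ _ _).symm (x j)) (by
      apply hP.hom_ext
      · rw [hP.inl_desc_assoc, reassoc_of% hdl, copowerEquiv_symm_comp, copowerMap_comp_symm, hab,
          Category.id_comp]
      · rw [hP.inr_desc_assoc, reassoc_of% hdr, copowerEquiv_symm_comp, copowerMap_comp_symm, heb,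
          eHomWhiskerRight_id, Category.comp_id]) (fun j hj ↦ by
      apply hP.hom_ext
      · rw [hP.inl_desc_assoc, reassoc_of% hdl, copowerEquiv_symm_comp, copowerMap_comp_symm,
          hax j hj, Category.id_comp]
      · rw [hP.inr_desc_assoc, reassoc_of% hdr, copowerEquiv_symm_comp, copowerMap_comp_symm,
          ← hex j hj, eHomWhiskerRight_id, Category.comp_id]) (fun j hj ↦ by
      rw [copowerEquiv_symm_comp, copowerEquiv_symm_comp, hxb j hj]) (by
      cases n with
      | zero => trivial
      | succ n =>
        intro p q hpq hq
        have h := hx n rfl p q hpq hq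
        simp only [eqToHom_refl, Category.id_comp] at h
        rw [copowerEquiv_symm_comp, copowerEquiv_symm_comp, h])
  refine ⟨copowerEquiv hN _ _ _ w, ?_, ?_, ?_, fun j hj ↦ ?_⟩
  · have h := congrArg (copowerEquiv hN _ _ _) (inr ≫= hw₁)
    rwa [hP.inr_desc, Equiv.apply_symm_apply, reassoc_of% hdr, copowerEquiv_map_comp,
      eHomWhiskerRight_id, Category.comp_id] at h
  · have h := congrArg (copowerEquiv hN _ _ _) (inl ≫= hw₁)
    rwa [hP.inl_desc, Equiv.apply_symm_apply, reassoc_of% hdl, copowerEquiv_map_comp,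
      Category.id_comp] at h
  · rw [← copowerEquiv_comp, hw₂, Equiv.apply_symm_apply]
  · rw [← copowerEquiv_comp, hw₃ j hj, Equiv.apply_symm_apply]

/-- The lifting property of the cobar resolutions relative to the matching objects. -/
lemma exists_cobar_matching_lift (hT : QuillenUnitCofibrant aF.adj.toMonad)
    {X Y : M} (f : X ⟶ Y)
    (hf : fibrations N (vf aG f 0)) (n k : ℕ) {A B : M} {i : A ⟶ B}
    (hi : trivialCofibrations N (umap U i))
    (a : Δ[k] ⟶ (A ⟶[SSet.{v}] G.obj (V aG X (n + 1))))
    (b : Δ[k] ⟶ (B ⟶[SSet.{v}] G.obj (V aG Y (n + 1))))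
    (e : (∂Δ[k] : SSet.{v}) ⟶ (B ⟶[SSet.{v}] G.obj (V aG X (n + 1))))
    (x : ℕ → (Δ[k] ⟶ (B ⟶[SSet.{v}] G.obj (V aG X n))))
    (hae : ∂Δ[k].ι ≫ a = e ≫ eHomWhiskerRight SSet.{v} i _)
    (hab : a ≫ eHomWhiskerLeft SSet.{v} _ (umap G (vf aG f (n + 1))) =
      b ≫ eHomWhiskerRight SSet.{v} i _)
    (heb : e ≫ eHomWhiskerLeft SSet.{v} _ (umap G (vf aG f (n + 1))) = ∂Δ[k].ι ≫ b)
    (hax : ∀ j ≤ n, x j ≫ eHomWhiskerRight SSet.{v} i _ =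
      a ≫ eHomWhiskerLeft SSet.{v} _ (umap G (vcod aG X n j)))
    (hex : ∀ j ≤ n, ∂Δ[k].ι ≫ x j = e ≫ eHomWhiskerLeft SSet.{v} _ (umap G (vcod aG X n j)))
    (hxb : ∀ j ≤ n, x j ≫ eHomWhiskerLeft SSet.{v} _ (umap G (vf aG f n)) =
      b ≫ eHomWhiskerLeft SSet.{v} _ (umap G (vcod aG Y n j)))
    (hx : ∀ m (hm : n = m + 1) p q, p ≤ q → q ≤ m →
      x p ≫ eHomWhiskerLeft SSet.{v} B
        (umap G (eqToHom (by rw [hm]) ≫ vcod aG X m q : V aG X n ⟶ V aG X m)) =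
        x (q + 1) ≫ eHomWhiskerLeft SSet.{v} B (umap G (eqToHom (by rw [hm]) ≫ vcod aG X m p))) :
    ∃ w : Δ[k] ⟶ (B ⟶[SSet.{v}] G.obj (V aG X (n + 1))), ∂Δ[k].ι ≫ w = e ∧
      w ≫ eHomWhiskerRight SSet.{v} i _ = a ∧
      w ≫ eHomWhiskerLeft SSet.{v} _ (umap G (vf aG f (n + 1))) = b ∧
      ∀ j ≤ n, w ≫ eHomWhiskerLeft SSet.{v} _ (umap G (vcod aG X n j)) = x j := by
  -- All objects and maps on the right are in the image of `G`, so the problem transposes along `U ⊣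
  -- G` to one for `U i` in `N`.
  obtain ⟨w, hw₁, hw₂, hw₃, hw₄⟩ := exists_simplicial_matching_lift aF aG hT f hf n k hi
    (a ≫ (aG.homIso _ _).inv) (b ≫ (aG.homIso _ _).inv) (e ≫ (aG.homIso _ _).inv)
    (fun j ↦ x j ≫ (aG.homIso _ _).inv) (by
      rw [Category.assoc, ← aG.whiskerRight_homIso_inv, reassoc_of% hae]) (by
      rw [Category.assoc, Category.assoc, ← aG.whiskerRight_homIso_inv,
        ← aG.whiskerLeft_homIso_inv, reassoc_of% hab]) (by
      rw [Category.assoc, ← aG.whiskerLeft_homIso_inv, reassoc_of% heb]) (fun j hj ↦ by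
      rw [Category.assoc, Category.assoc, ← aG.whiskerRight_homIso_inv,
        ← aG.whiskerLeft_homIso_inv, reassoc_of% hax j hj]) (fun j hj ↦ by
      rw [Category.assoc, ← aG.whiskerLeft_homIso_inv, reassoc_of% hex j hj]) (fun j hj ↦ by
      rw [Category.assoc, Category.assoc, ← aG.whiskerLeft_homIso_inv,
        ← aG.whiskerLeft_homIso_inv, reassoc_of% hxb j hj]) (fun m hm p q hpq hq ↦ by
      rw [Category.assoc, Category.assoc, ← aG.whiskerLeft_homIso_inv,
        ← aG.whiskerLeft_homIso_inv, reassoc_of% hx m hm p q hpq hq])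
  refine ⟨w ≫ (aG.homIso _ _).hom, ?_, ?_, ?_, fun j hj ↦ ?_⟩
  · rw [reassoc_of% hw₁, Iso.inv_hom_id, Category.comp_id]
  · rw [Category.assoc, ← aG.whiskerRight_homIso_hom, reassoc_of% hw₂, Iso.inv_hom_id,
      Category.comp_id]
  · rw [Category.assoc, ← aG.whiskerLeft_homIso_hom, reassoc_of% hw₃, Iso.inv_hom_id,
      Category.comp_id]
  · rw [Category.assoc, ← aG.whiskerLeft_homIso_hom, reassoc_of% hw₄ j hj, Iso.inv_hom_id,
      Category.comp_id]

end SimplicialMatching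

/-! ### Gluing along the faces of a boundary -/

section Boundary

/-- The multicoequalizer diagram which expresses `∂Δ[n]` as a gluing of its faces. -/
lemma boundary_multicoequalizerDiagram (n : ℕ) :
    SSet.Subcomplex.MulticoequalizerDiagram (SSet.boundary.{v} n)
      (ι := Fin (n + 1)) (fun j ↦ SSet.stdSimplex.face {j}ᶜ)
      (fun j k ↦ SSet.stdSimplex.face {j, k}ᶜ) where
  iSup_eq := by rw [SSet.boundary_eq_iSup]
  eq_inf j k := by
    rw [SSet.stdSimplex.face_inter_face]
    congr
    aesop

open SSet.stdSimplex in
/-- Glueing of maps along the faces of the boundary of a simplex. -/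
lemma exists_boundary_desc {Z : SSet.{v}} (n : ℕ) (f : Fin (n + 2) → (Δ[n] ⟶ Z))
    (hf : ∀ m < n, ∀ (θ θ' : ⦋m⦌ ⟶ ⦋n⦌) (p q : Fin (n + 2)),
      θ ≫ SimplexCategory.δ p = θ' ≫ SimplexCategory.δ q →
        SSet.stdSimplex.map θ ≫ f p = SSet.stdSimplex.map θ' ≫ f q) :
    ∃ φ : (∂Δ[n + 1] : SSet.{v}) ⟶ Z, ∀ i, SSet.boundary.ι i ≫ φ = f i := by
  have key (a b : Fin (n + 2)) (hab : a < b)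
      (h₁ : (face {a, b}ᶜ : Δ[n + 1].Subcomplex) ≤ face {a}ᶜ)
      (h₂ : (face {a, b}ᶜ : Δ[n + 1].Subcomplex) ≤ face {b}ᶜ) :
      SSet.Subcomplex.homOfLE h₁ ≫ (faceSingletonComplIso.{v} a).inv ≫ f a =
        SSet.Subcomplex.homOfLE h₂ ≫ (faceSingletonComplIso.{v} b).inv ≫ f b := by
    obtain _ | n := n
    -- The two faces of an interval are disjoint, so there is nothing to check.
    · ext ⟨⟨k⟩⟩ ⟨x, hx⟩
      exfalso
      have h0 := (mem_face_iff _ _).1 hx 0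
      generalize x 0 = y at h0
      simp only [Finset.mem_compl, Finset.mem_insert, Finset.mem_singleton, not_or] at h0
      omega
    · rw [homOfLE_faceSingletonComplIso_inv_eq_facePairComplIso_inv_δ_pred_assoc _ _ hab,
          homOfLE_faceSingletonComplIso_inv_eq_facePairComplIso_inv_δ_castPred_assoc _ _ hab]
      congr 1
      apply hf n (by omega)
      obtain ⟨a, rfl⟩ := a.eq_castSucc_of_ne_last (Fin.ne_last_of_lt hab)
      obtain ⟨b, rfl⟩ := b.eq_succ_of_ne_zero (Fin.ne_zero_of_lt hab)
      rw [Fin.pred_succ, Fin.castPred_castSucc, SimplexCategory.δ_comp_δ (by grind)]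
  let D := boundary_multicoequalizerDiagram.{v} (n + 1)
  let c : Multicofork (D.multispanIndex.toLinearOrder.map SSet.Subcomplex.toSSetFunctor) :=
    Multicofork.ofπ _ Z (fun j ↦ (faceSingletonComplIso j).inv ≫ f j)
      (by rintro ⟨⟨a, b⟩, hab⟩; exact key a b hab (by simp [face_le_face_iff]) (by simp [face_le_face_iff]))
  obtain ⟨φ, hφ⟩ : ∃ φ : (∂Δ[n + 1] : SSet.{v}) ⟶ Z, ∀ j,
      SSet.boundary.faceι j ≫ φ = (faceSingletonComplIso j).inv ≫ f j :=
    ⟨D.isColimit'.desc c, fun j ↦ D.isColimit'.fac c (.right j)⟩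
  refine ⟨φ, fun j ↦ ?_⟩
  rw [← cancel_epi (faceSingletonComplIso j).inv, ← hφ,
    SSet.boundary.faceSingletonComplIso_inv_ι_assoc]

end Boundary

/-! ### The Reedy induction for totalizations -/

section Reedy

variable {C : Type u₁} [Category.{v} C] [SimplicialCategory C]
  {𝒳 𝒴 : CosimplicialObject C} (f : 𝒳 ⟶ 𝒴) {A B : C} (i : A ⟶ B)

/-- The lifting properties of a map `f` of cosimplicial objects, relative to its matching objects,
that suffice for the map induced by `f` on totalizations to have the right lifting property
against `i`. -/
structure MatchingLifts : Prop where
  zero (a : Δ[0] ⟶ (A ⟶[SSet.{v}] 𝒳.obj ⦋0⦌)) (b : Δ[0] ⟶ (B ⟶[SSet.{v}] 𝒴.obj ⦋0⦌))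
    (hab : a ≫ eHomWhiskerLeft SSet.{v} _ (f.app _) = b ≫ eHomWhiskerRight SSet.{v} i _) :
    ∃ w : Δ[0] ⟶ (B ⟶[SSet.{v}] 𝒳.obj ⦋0⦌), w ≫ eHomWhiskerRight SSet.{v} i _ = a ∧
      w ≫ eHomWhiskerLeft SSet.{v} _ (f.app _) = b
  succ (n : ℕ) (a : Δ[n + 1] ⟶ (A ⟶[SSet.{v}] 𝒳.obj ⦋n + 1⦌))
    (b : Δ[n + 1] ⟶ (B ⟶[SSet.{v}] 𝒴.obj ⦋n + 1⦌))
    (e : (∂Δ[n + 1] : SSet.{v}) ⟶ (B ⟶[SSet.{v}] 𝒳.obj ⦋n + 1⦌))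
    (x : Δ[n] ⟶ (B ⟶[SSet.{v}] 𝒳.obj ⦋n⦌))
    (hae : ∂Δ[n + 1].ι ≫ a = e ≫ eHomWhiskerRight SSet.{v} i _)
    (hab : a ≫ eHomWhiskerLeft SSet.{v} _ (f.app _) = b ≫ eHomWhiskerRight SSet.{v} i _)
    (heb : e ≫ eHomWhiskerLeft SSet.{v} _ (f.app _) = ∂Δ[n + 1].ι ≫ b)
    (hax : ∀ j, SSet.stdSimplex.map (SimplexCategory.σ j) ≫ x ≫ eHomWhiskerRight SSet.{v} i _ =
      a ≫ eHomWhiskerLeft SSet.{v} _ (𝒳.map (SimplexCategory.σ j)))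
    (hex : ∀ j, ∂Δ[n + 1].ι ≫ SSet.stdSimplex.map (SimplexCategory.σ j) ≫ x =
      e ≫ eHomWhiskerLeft SSet.{v} _ (𝒳.map (SimplexCategory.σ j)))
    (hxb : ∀ j, SSet.stdSimplex.map (SimplexCategory.σ j) ≫ x ≫
      eHomWhiskerLeft SSet.{v} _ (f.app _) =
        b ≫ eHomWhiskerLeft SSet.{v} _ (𝒴.map (SimplexCategory.σ j)))
    (hx : ∀ m < n, ∃ y : Δ[m] ⟶ (B ⟶[SSet.{v}] 𝒳.obj ⦋m⦌), ∀ φ : ⦋n⦌ ⟶ ⦋m⦌,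
      x ≫ eHomWhiskerLeft SSet.{v} _ (𝒳.map φ) = SSet.stdSimplex.map φ ≫ y) :
    ∃ w : Δ[n + 1] ⟶ (B ⟶[SSet.{v}] 𝒳.obj ⦋n + 1⦌), ∂Δ[n + 1].ι ≫ w = e ∧
      w ≫ eHomWhiskerRight SSet.{v} i _ = a ∧ w ≫ eHomWhiskerLeft SSet.{v} _ (f.app _) = b ∧
      ∀ j, w ≫ eHomWhiskerLeft SSet.{v} _ (𝒳.map (SimplexCategory.σ j)) =
        SSet.stdSimplex.map (SimplexCategory.σ j) ≫ x

/-- A lift, in degrees at most `n`, for the lifting problem given by cosimplicial maps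
`Δ[•] ⟶ Map(A, 𝒳)` and `Δ[•] ⟶ Map(B, 𝒴)`. -/
structure PartialLift (a : ∀ k : ℕ, Δ[k] ⟶ (A ⟶[SSet.{v}] 𝒳.obj ⦋k⦌))
    (b : ∀ k : ℕ, Δ[k] ⟶ (B ⟶[SSet.{v}] 𝒴.obj ⦋k⦌)) (n : ℕ) where
  /-- the lift -/
  w (k : ℕ) (hk : k ≤ n) : Δ[k] ⟶ (B ⟶[SSet.{v}] 𝒳.obj ⦋k⦌)
  compat (k l : ℕ) (hk : k ≤ n) (hl : l ≤ n) (φ : ⦋k⦌ ⟶ ⦋l⦌) :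
    SSet.stdSimplex.map φ ≫ w l hl = w k hk ≫ eHomWhiskerLeft SSet.{v} _ (𝒳.map φ)
  whiskerRight (k : ℕ) (hk : k ≤ n) : w k hk ≫ eHomWhiskerRight SSet.{v} i _ = a k
  whiskerLeft (k : ℕ) (hk : k ≤ n) : w k hk ≫ eHomWhiskerLeft SSet.{v} _ (f.app _) = b k

variable {f i} {a : ∀ k : ℕ, Δ[k] ⟶ (A ⟶[SSet.{v}] 𝒳.obj ⦋k⦌)}
  {b : ∀ k : ℕ, Δ[k] ⟶ (B ⟶[SSet.{v}] 𝒴.obj ⦋k⦌)}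

lemma whiskerLeft_map_comp (𝒳 : CosimplicialObject C) (A : C) {k l m : SimplexCategory}
    (φ : k ⟶ l) (ψ : l ⟶ m) :
    eHomWhiskerLeft SSet.{v} A (𝒳.map φ) ≫ eHomWhiskerLeft SSet.{v} A (𝒳.map ψ) =
      eHomWhiskerLeft SSet.{v} A (𝒳.map (φ ≫ ψ)) := by
  rw [← eHomWhiskerLeft_comp]
  exact congrArg _ (𝒳.map_comp φ ψ).symm

lemma stdSimplex_map_comp_assoc {k l m : SimplexCategory} (φ : k ⟶ l) (ψ : l ⟶ m) {Z : SSet.{v}}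
    (g : SSet.stdSimplex.obj m ⟶ Z) :
    SSet.stdSimplex.map φ ≫ SSet.stdSimplex.map ψ ≫ g = SSet.stdSimplex.map (φ ≫ ψ) ≫ g := by
  rw [← Category.assoc]
  exact congrArg (· ≫ g) (SSet.stdSimplex.map_comp φ ψ).symm

/-- Compatibility with cofaces determines the new simplex on its boundary, and compatibility with
codegeneracies determines its image in the matching object. A simplex with these two properties is
automatically compatible with every operator, because a noninvertible operator into or out of degree
`n + 1` factors through a coface or a codegeneracy. -/
lemma PartialLift.exists_succ (hf : MatchingLifts f i)
    (ha : ∀ {k l : ℕ} (φ : ⦋k⦌ ⟶ ⦋l⦌), SSet.stdSimplex.map φ ≫ a l =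
      a k ≫ eHomWhiskerLeft SSet.{v} _ (𝒳.map φ))
    (hb : ∀ {k l : ℕ} (φ : ⦋k⦌ ⟶ ⦋l⦌), SSet.stdSimplex.map φ ≫ b l =
      b k ≫ eHomWhiskerLeft SSet.{v} _ (𝒴.map φ))
    (hab : ∀ k, a k ≫ eHomWhiskerLeft SSet.{v} _ (f.app _) =
      b k ≫ eHomWhiskerRight SSet.{v} i _)
    {n : ℕ} (p : PartialLift f i a b n) :
    ∃ q : PartialLift f i a b (n + 1), ∀ k hk, q.w k (Nat.le_succ_of_le hk) = p.w k hk := by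
  obtain ⟨e, he⟩ := exists_boundary_desc n
    (fun j ↦ p.w n le_rfl ≫ eHomWhiskerLeft SSet.{v} _ (𝒳.map (SimplexCategory.δ j)))
    (fun m hm θ θ' j k h ↦ by
      rw [← Category.assoc, ← Category.assoc, p.compat m n hm.le le_rfl,
        p.compat m n hm.le le_rfl, Category.assoc, Category.assoc, whiskerLeft_map_comp,
        whiskerLeft_map_comp, h])
  have hι (j : Fin (n + 2)) {Z : SSet.{v}} (g : Δ[n + 1] ⟶ Z) : SSet.boundary.ι j ≫ ∂Δ[n + 1].ι ≫ g =
      SSet.stdSimplex.map (SimplexCategory.δ j) ≫ g := SSet.boundary.ι_ι_assoc j g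
  obtain ⟨w, hwe, hwi, hwf, hwσ⟩ := hf.succ n (a (n + 1)) (b (n + 1)) e (p.w n le_rfl) (by
      refine SSet.boundary.hom_ext (fun j ↦ ?_)
      rw [hι, reassoc_of% he j, ha, eHom_whisker_exchange, ← Category.assoc, p.whiskerRight])
    (hab _) (by
      refine SSet.boundary.hom_ext (fun j ↦ ?_)
      rw [hι, reassoc_of% he j, hb, ← eHomWhiskerLeft_comp, f.naturality, eHomWhiskerLeft_comp,
        ← Category.assoc, p.whiskerLeft]) (fun j ↦ by
      rw [p.whiskerRight, ha]) (fun j ↦ by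
      refine SSet.boundary.hom_ext (fun k ↦ ?_)
      rw [hι, reassoc_of% he k, stdSimplex_map_comp_assoc, p.compat, whiskerLeft_map_comp])
    (fun j ↦ by rw [p.whiskerLeft, hb])
    (fun m hm ↦ ⟨p.w m hm.le, fun φ ↦ (p.compat _ _ _ _ φ).symm⟩)
  have hwδ (j) : SSet.stdSimplex.map (SimplexCategory.δ j) ≫ w =
      p.w n le_rfl ≫ eHomWhiskerLeft SSet.{v} _ (𝒳.map (SimplexCategory.δ j)) := by
    rw [← he, ← hwe, hι]
  let w' (k : ℕ) (hk : k ≤ n + 1) : Δ[k] ⟶ (B ⟶[SSet.{v}] 𝒳.obj ⦋k⦌) :=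
    if h : k ≤ n then p.w k h else by
      obtain rfl : k = n + 1 := by omega
      exact w
  have hw' (k : ℕ) (hk : k ≤ n) : w' k (Nat.le_succ_of_le hk) = p.w k hk := dif_pos hk
  have hw'' : w' (n + 1) le_rfl = w := dif_neg (by omega)
  have aux (k : ℕ) (hk : k ≤ n) (φ : ⦋k⦌ ⟶ ⦋n + 1⦌) :
      SSet.stdSimplex.map φ ≫ w = p.w k hk ≫ eHomWhiskerLeft SSet.{v} _ (𝒳.map φ) := by
    obtain ⟨j, θ, rfl⟩ := SimplexCategory.eq_comp_δ_of_not_surjective φ (fun h ↦ by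
      have : Epi φ := SimplexCategory.epi_iff_surjective.2 h
      have := SimplexCategory.len_le_of_epi φ
      simp at this
      omega)
    rw [← stdSimplex_map_comp_assoc, hwδ, ← Category.assoc, p.compat k n hk le_rfl,
      Category.assoc, whiskerLeft_map_comp]
  refine ⟨⟨w', ?_, ?_, ?_⟩, hw'⟩
  · intro k l hk hl φ
    obtain hk' | rfl := Nat.le_succ_iff.1 hk
    · obtain hl' | rfl := Nat.le_succ_iff.1 hl
      · rw [hw' _ hk', hw' _ hl', p.compat]
      · rw [hw' _ hk', hw'', aux k hk']
    · rw [hw'']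
      -- An injective operator out of the top degree must be the identity; any other one begins with
      -- a codegeneracy, for which compatibility is already known.
      by_cases h : Function.Injective φ.toOrderHom
      · have : Mono φ := SimplexCategory.mono_iff_injective.2 h
        have := SimplexCategory.len_le_of_mono φ
        simp at this
        obtain rfl : l = n + 1 := by omega
        rw [SimplexCategory.eq_id_of_mono φ, hw'']
        have h₁ : SSet.stdSimplex.map (𝟙 ⦋n + 1⦌) ≫ w = w :=
          (congrArg (· ≫ w) (SSet.stdSimplex.map_id _)).trans (Category.id_comp w)
        have h₂ : 𝒳.map (𝟙 ⦋n + 1⦌) = 𝟙 _ := 𝒳.map_id _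
        rw [h₁, h₂, eHomWhiskerLeft_id, Category.comp_id]
      · obtain ⟨j, θ, rfl⟩ := SimplexCategory.eq_σ_comp_of_not_injective φ h
        rw [← stdSimplex_map_comp_assoc, ← whiskerLeft_map_comp, reassoc_of% hwσ j]
        congr 1
        obtain hl' | rfl := Nat.le_succ_iff.1 hl
        · rw [hw' _ hl', p.compat]
        · rw [hw'', aux _ le_rfl]
  · intro k hk
    obtain hk' | rfl := Nat.le_succ_iff.1 hk
    · rw [hw' _ hk', p.whiskerRight]
    · rw [hw'', hwi]
  · intro k hk
    obtain hk' | rfl := Nat.le_succ_iff.1 hk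
    · rw [hw' _ hk', p.whiskerLeft]
    · rw [hw'', hwf]

/-- Successive choices of extensions stabilize in each degree, so the values of the `k`-th partial
lift in degree `k` assemble; an operator is checked in a partial lift containing both of its
degrees. -/
lemma exists_lift_of_matchingLifts (hf : MatchingLifts f i)
    (ha : ∀ {k l : ℕ} (φ : ⦋k⦌ ⟶ ⦋l⦌), SSet.stdSimplex.map φ ≫ a l =
      a k ≫ eHomWhiskerLeft SSet.{v} _ (𝒳.map φ))
    (hb : ∀ {k l : ℕ} (φ : ⦋k⦌ ⟶ ⦋l⦌), SSet.stdSimplex.map φ ≫ b l =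
      b k ≫ eHomWhiskerLeft SSet.{v} _ (𝒴.map φ))
    (hab : ∀ k, a k ≫ eHomWhiskerLeft SSet.{v} _ (f.app _) =
      b k ≫ eHomWhiskerRight SSet.{v} i _) :
    ∃ w : ∀ k : ℕ, Δ[k] ⟶ (B ⟶[SSet.{v}] 𝒳.obj ⦋k⦌),
      (∀ {k l : ℕ} (φ : ⦋k⦌ ⟶ ⦋l⦌), SSet.stdSimplex.map φ ≫ w l =
        w k ≫ eHomWhiskerLeft SSet.{v} _ (𝒳.map φ)) ∧
      (∀ k, w k ≫ eHomWhiskerRight SSet.{v} i _ = a k) ∧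
      (∀ k, w k ≫ eHomWhiskerLeft SSet.{v} _ (f.app _) = b k) := by
  obtain ⟨w₀, hw₀i, hw₀f⟩ := hf.zero (a 0) (b 0) (hab 0)
  let p₀ : PartialLift f i a b 0 :=
    { w := fun k hk ↦ by
        obtain rfl : k = 0 := by omega
        exact w₀
      compat := fun k l hk hl φ ↦ by
        obtain rfl : k = 0 := by omega
        obtain rfl : l = 0 := by omega
        obtain rfl : φ = 𝟙 _ := Subsingleton.elim _ _
        have h₁ : SSet.stdSimplex.map (𝟙 ⦋0⦌) ≫ w₀ = w₀ :=
          (congrArg (· ≫ w₀) (SSet.stdSimplex.map_id _)).trans (Category.id_comp w₀)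
        have h₂ : 𝒳.map (𝟙 ⦋0⦌) = 𝟙 _ := 𝒳.map_id _
        refine h₁.trans ?_
        rw [h₂, eHomWhiskerLeft_id, Category.comp_id]
      whiskerRight := fun k hk ↦ by
        obtain rfl : k = 0 := by omega
        exact hw₀i
      whiskerLeft := fun k hk ↦ by
        obtain rfl : k = 0 := by omega
        exact hw₀f }
  let p (n : ℕ) : PartialLift f i a b n :=
    Nat.rec p₀ (fun n q ↦ (q.exists_succ hf ha hb hab).choose) n
  have hp (n k : ℕ) (hk : k ≤ n) : (p (n + 1)).w k (Nat.le_succ_of_le hk) = (p n).w k hk :=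
    ((p n).exists_succ hf ha hb hab).choose_spec k hk
  have hp' (n k : ℕ) (hk : k ≤ n) : (p n).w k hk = (p k).w k le_rfl := by
    induction n, hk using Nat.le_induction with
    | base => rfl
    | succ n hk ih => rw [hp _ _ hk, ih]
  refine ⟨fun k ↦ (p k).w k le_rfl, fun {k l} φ ↦ ?_, fun k ↦ (p k).whiskerRight k _,
    fun k ↦ (p k).whiskerLeft k _⟩
  change SSet.stdSimplex.map φ ≫ (p l).w l le_rfl = (p k).w k le_rfl ≫ _
  rw [← hp' (max k l) k (le_max_left _ _), ← hp' (max k l) l (le_max_right _ _),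
    (p _).compat]

/-- The map induced on totalizations by a map with the relative matching lifting
properties against `i` has the right lifting property against `i`. -/
lemma hasLiftingProperty_totalization (hf : MatchingLifts f i) (TX : Totalization 𝒳)
    (TY : Totalization 𝒴) (t : TX.pt ⟶ TY.pt)
    (ht : ∀ n, TY.π n ≫ eHomWhiskerRight SSet.{v} t (𝒴.obj n) =
      TX.π n ≫ eHomWhiskerLeft SSet.{v} TX.pt (f.app n)) : HasLiftingProperty i t := by
  refine ⟨fun {g h} sq ↦ ?_⟩
  obtain ⟨w, hw, hwi, hwf⟩ := exists_lift_of_matchingLifts hf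
    (a := fun k ↦ TX.π ⦋k⦌ ≫ eHomWhiskerRight SSet.{v} g _)
    (b := fun k ↦ TY.π ⦋k⦌ ≫ eHomWhiskerRight SSet.{v} h _)
    (fun {k l} φ ↦ by
      have := TX.w φ
      rw [reassoc_of% this, Category.assoc, eHom_whisker_exchange])
    (fun {k l} φ ↦ by
      have := TY.w φ
      rw [reassoc_of% this, Category.assoc, eHom_whisker_exchange]) (fun k ↦ by
      rw [Category.assoc, ← eHom_whisker_exchange, ← reassoc_of% ht ⦋k⦌, Category.assoc,
        ← eHomWhiskerRight_comp, ← eHomWhiskerRight_comp, sq.w])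
  refine ⟨⟨TX.lift B (fun n ↦ w n.len) (fun φ ↦ hw φ), ?_, ?_⟩⟩
  · refine TX.hom_ext (fun n ↦ ?_)
    rw [eHomWhiskerRight_comp, ← Category.assoc, TX.lift_fac]
    exact hwi n.len
  · refine TY.hom_ext (fun n ↦ ?_)
    rw [eHomWhiskerRight_comp, ← Category.assoc, ht, Category.assoc, eHom_whisker_exchange,
      ← Category.assoc, TX.lift_fac]
    exact hwf n.len

end Reedy

/-! ### The cobar resolution satisfies the matching conditions -/

section CobarMatching

variable {M : Type u₁} [Category.{v} M] [SimplicialCategory M]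
  {N : Type u₂} [Category.{v} N] [SimplicialCategory N]
  {U : EnrichedFunctor SSet.{v} M N} {F G : EnrichedFunctor SSet.{v} N M}
  (aF : SimplicialAdjunction F U) (aG : SimplicialAdjunction U G)

/-- If `j = n`, the two outermost copies of `GU` are multiplied, and the multiplication is `G ε U`.
If `j < n`, the recursive formula first inserts an outer unit and then multiplies it away, which
leaves `GU` applied to the same operator one level lower. -/
lemma iterMap_eq_umap_vcod (X : M) {n j : ℕ} (hj : j ≤ n) (φ : Fin (n + 2) →o Fin (n + 1))
    (hφ : ∀ i, (φ i).val = if i.val ≤ j then i.val else i.val - 1) :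
    iterMap aG.adj.toMonad X (n + 2) (n + 1) φ = umap G (vcod aG X n j) := by
  have hlast : φ (Fin.last (n + 1)) = Fin.last n := by
    ext
    rw [hφ, Fin.val_last, if_neg (by omega)]
    rfl
  rw [iterMap_of_eq _ _ _ hlast]
  obtain rfl | hj := hj.eq_or_lt
  · have hinit : init φ = OrderHom.id := by
      ext i
      change (φ i.castSucc).val = i.val
      rw [hφ, Fin.val_castSucc, if_pos (by omega)]
    rw [hinit, iterMap_id, iterT_id, Category.id_comp, vcod_last]
    rfl
  · match n, hj with
    | n + 1, hj =>
      have hne : init φ (Fin.last (n + 1)) ≠ Fin.last (n + 1) := by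
        intro h
        have h' := congrArg Fin.val h
        change (φ (Fin.last (n + 1)).castSucc).val = _ at h'
        rw [hφ, Fin.val_castSucc, Fin.val_last, if_neg (by omega)] at h'
        omega
      rw [iterMap_of_ne _ _ _ hne, iterT_comp, Category.assoc, iterT_unit_mul, Category.comp_id,
        vcod_of_le _ _ (by omega), iterMap_eq_umap_vcod X (j := j) (by omega)
          (corestrict (init φ) hne) (fun i ↦ hφ i.castSucc)]
      rfl

lemma cobar_map_σ (X : M) (n : ℕ) (j : Fin (n + 1)) :
    (cobar aG.adj.toMonad X).map (SimplexCategory.σ j) = umap G (vcod aG X n j) :=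
  iterMap_eq_umap_vcod aG X (Nat.le_of_lt_succ j.2) _ (fun i ↦ by
    change (j.predAbove i).val = _
    rw [Fin.predAbove]
    split_ifs with h₁ h₂ h₂ <;> rw [Fin.lt_def, Fin.val_castSucc] at h₁ <;> first | omega | simp)

variable [ModelCategory N]

lemma matchingLifts_cobarMap [SimplicialModelCategory N] (hT : QuillenUnitCofibrant aF.adj.toMonad)
    {X Y : M} (f : X ⟶ Y) (hf : fibrations N (umap U f)) {A B : M} {i : A ⟶ B}
    (hi : trivialCofibrations N (umap U i)) : MatchingLifts (cobarMap aG.adj.toMonad f) i where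
  zero a b hab := by
    obtain ⟨a, rfl⟩ := exists_eq_constMap SSet.stdSimplex.isTerminalObj₀ a
    obtain ⟨b, rfl⟩ := exists_eq_constMap SSet.stdSimplex.isTerminalObj₀ b
    rw [Totalization.constMap_comp_whiskerLeft, Totalization.constMap_comp_whiskerRight] at hab
    have hab' := constMap_injective (SSet.stdSimplex.isTerminalObj₀.from _) hab
    have h : HasLiftingProperty (umap U i) (umap U f) := by
      rw [← MorphismProperty.llp_eq_of_wfs (trivialCofibrations N) (fibrations N)] at hi
      exact hi _ hf
    -- In degree zero the matching object is trivial, and the map is `G U f`: transpose along `U ⊣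
    -- G`.
    have h' : HasLiftingProperty i (umap G (umap U f)) :=
      (aG.adj.hasLiftingProperty_iff _ _).1 h
    have sq : CommSq a i (umap G (umap U f)) b := ⟨hab'⟩
    have : sq.HasLift := h'.sq_hasLift sq
    obtain ⟨l, hl₁, hl₂⟩ : ∃ l, i ≫ l = a ∧ l ≫ umap G (umap U f) = b :=
      ⟨sq.lift, sq.fac_left, sq.fac_right⟩
    refine ⟨constMap _ l, ?_, ?_⟩
    · rw [← hl₁]
      exact Totalization.constMap_comp_whiskerRight _ _ _
    · rw [← hl₂]
      exact Totalization.constMap_comp_whiskerLeft _ _ _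
  succ n a b e x hae hab heb hax hex hxb hx := by
    have key (Z : M) (j : ℕ) (hj : j ≤ n) :
        umap G (vcod aG Z n j) = (cobar aG.adj.toMonad Z).map
          (SimplexCategory.σ (⟨j, Nat.lt_succ_of_le hj⟩ : Fin (n + 1))) :=
      (cobar_map_σ aG Z n ⟨j, _⟩).symm
    obtain ⟨w, hw₁, hw₂, hw₃, hw₄⟩ := exists_cobar_matching_lift aF aG hT f hf n (n + 1) hi a b e
      (fun j ↦ if hj : j ≤ n then
        SSet.stdSimplex.map (SimplexCategory.σ (⟨j, Nat.lt_succ_of_le hj⟩ : Fin (n + 1))) ≫ x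
        else SSet.stdSimplex.map (SimplexCategory.σ 0) ≫ x) hae hab heb (fun j hj ↦ by
        rw [dif_pos hj, key _ j hj]
        exact (Category.assoc _ _ _).trans (hax _)) (fun j hj ↦ by
        rw [dif_pos hj, key _ j hj]
        exact hex _) (fun j hj ↦ by
        rw [dif_pos hj, key _ j hj]
        exact (Category.assoc _ _ _).trans (hxb _)) (fun m hm p q hpq hq ↦ by
        subst hm
        rw [dif_pos (by omega), dif_pos (by omega)]
        simp only [eqToHom_refl, Category.id_comp]
        obtain ⟨y, hy⟩ := hx m (Nat.lt_succ_self m)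
        have e₁ : umap G (vcod aG X m p) = (cobar aG.adj.toMonad X).map
          (SimplexCategory.σ (⟨p, by omega⟩ : Fin (m + 1))) := (cobar_map_σ aG X m ⟨p, _⟩).symm
        have e₂ : umap G (vcod aG X m q) = (cobar aG.adj.toMonad X).map
          (SimplexCategory.σ (⟨q, by omega⟩ : Fin (m + 1))) := (cobar_map_σ aG X m ⟨q, _⟩).symm
        rw [e₁, e₂]
        refine (Category.assoc _ _ _).trans (Eq.trans ?_ (Category.assoc _ _ _).symm)
        have h₁ := hy (SimplexCategory.σ (⟨p, by omega⟩ : Fin (m + 1)))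
        have h₂ := hy (SimplexCategory.σ (⟨q, by omega⟩ : Fin (m + 1)))
        -- Both sides are degeneracies of the same simplex `y`, so matching compatibility is the
        -- simplicial identity for codegeneracies.
        have h₃ := SimplexCategory.σ_comp_σ (n := m) (i := ⟨p, by omega⟩) (j := ⟨q, by omega⟩) hpq
        refine (congrArg (_ ≫ ·) h₂).trans (Eq.trans ?_ (congrArg (_ ≫ ·) h₁).symm)
        rw [stdSimplex_map_comp_assoc, stdSimplex_map_comp_assoc]
        exact congrArg (fun t ↦ SSet.stdSimplex.map t ≫ y) h₃)
    refine ⟨w, hw₁, hw₂, hw₃, fun j ↦ ?_⟩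
    have := hw₄ j (Nat.le_of_lt_succ j.2)
    rw [dif_pos (Nat.le_of_lt_succ j.2), key _ j.1 (Nat.le_of_lt_succ j.2)] at this
    exact this

/-- The cobar construction takes `U`-fibrations to injective fibrations. -/
lemma injectiveFibrations_totMap [SimplicialModelCategory N]
    (hT : QuillenUnitCofibrant aF.adj.toMonad)
    (Tot : ∀ X : M, Totalization (cobar aG.adj.toMonad X)) {X Y : M} (f : X ⟶ Y)
    (hf : uFibrations (underlying U) f) :
    injectiveFibrations (underlying U) (totMap aG.adj.toMonad Tot f) := fun _ _ _ hi ↦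
  hasLiftingProperty_totalization (matchingLifts_cobarMap aF aG hT f hf hi) _ _ _
    (totMap_fac _ Tot f)

end CobarMatching

/-! ### Maps of simplicial sets described on simplices -/

section Simplices

/-- Maps of simplicial sets are equal if they agree on simplices. -/
lemma simplexwise_ext {X Z : SSet.{v}} {f g : X ⟶ Z}
    (h : ∀ (n : SimplexCategory) (x : SSet.stdSimplex.obj n ⟶ X), x ≫ f = x ≫ g) : f = g := by
  ext n x
  have := h n.unop (SSet.yonedaEquiv.symm x)
  rw [SSet.yonedaEquiv_symm_comp, SSet.yonedaEquiv_symm_comp] at this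
  exact SSet.yonedaEquiv.symm.injective this

/-- The map of simplicial sets with prescribed compositions with simplices. -/
lemma exists_simplexwise {X Z : SSet.{v}}
    (g : ∀ n : SimplexCategory, (SSet.stdSimplex.obj n ⟶ X) → (SSet.stdSimplex.obj n ⟶ Z))
    (hg : ∀ {m n : SimplexCategory} (θ : m ⟶ n) (x : SSet.stdSimplex.obj n ⟶ X),
      SSet.stdSimplex.map θ ≫ g n x = g m (SSet.stdSimplex.map θ ≫ x)) :
    ∃ f : X ⟶ Z, ∀ n x, x ≫ f = g n x := by
  refine ⟨{ app := fun n ↦ TypeCat.ofHom fun x ↦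
      SSet.yonedaEquiv (g n.unop (SSet.yonedaEquiv.symm x)), naturality := ?_ }, ?_⟩
  · intro n m φ
    ext x
    change SSet.yonedaEquiv (g m.unop (SSet.yonedaEquiv.symm (X.map φ x))) =
      Z.map φ (SSet.yonedaEquiv (g n.unop (SSet.yonedaEquiv.symm x)))
    refine Eq.trans ?_ (SSet.yonedaEquiv_naturality φ.unop (g n.unop (SSet.yonedaEquiv.symm x))).symm
    refine congrArg SSet.yonedaEquiv (Eq.trans ?_ (hg φ.unop _).symm)
    exact congrArg (g m.unop) (SSet.yonedaEquiv_symm_naturality_left φ.unop x).symm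
  · intro n x
    apply SSet.yonedaEquiv.injective
    rw [SSet.yonedaEquiv_comp]
    change SSet.yonedaEquiv (g n (SSet.yonedaEquiv.symm (SSet.yonedaEquiv x))) = _
    rw [Equiv.symm_apply_apply]

/-- The morphism of the simplex category which corresponds to a map between standard
simplices. -/
def simplexHom {m n : SimplexCategory} (x : SSet.stdSimplex.{v}.obj m ⟶ SSet.stdSimplex.obj n) :
    m ⟶ n :=
  SSet.stdSimplex.fullyFaithful.preimage x

lemma map_simplexHom {m n : SimplexCategory}
    (x : SSet.stdSimplex.{v}.obj m ⟶ SSet.stdSimplex.obj n) :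
    SSet.stdSimplex.map (simplexHom x) = x :=
  SSet.stdSimplex.fullyFaithful.map_preimage x

lemma simplexHom_map {m n : SimplexCategory} (θ : m ⟶ n) :
    simplexHom (SSet.stdSimplex.{v}.map θ) = θ :=
  SSet.stdSimplex.fullyFaithful.{v}.preimage_map θ

lemma simplexHom_map_comp {l m n : SimplexCategory} (θ : l ⟶ m)
    (x : SSet.stdSimplex.{v}.obj m ⟶ SSet.stdSimplex.obj n) :
    simplexHom (SSet.stdSimplex.map θ ≫ x) = θ ≫ simplexHom x := by
  apply SSet.stdSimplex.{v}.map_injective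
  exact (map_simplexHom _).trans ((congrArg (_ ≫ ·) (map_simplexHom x)).symm.trans
    (SSet.stdSimplex.map_comp _ _).symm)

end Simplices

/-! ### Pointwise composition of families -/

section PointwiseComp

variable {C : Type u₁} [Category.{v} C] [SimplicialCategory C]

/-- The pointwise composition of families of maps indexed by a simplicial set. -/
def pcomp {K : SSet.{v}} {X Y Z : C} (a : K ⟶ (X ⟶[SSet.{v}] Y)) (b : K ⟶ (Y ⟶[SSet.{v}] Z)) :
    K ⟶ (X ⟶[SSet.{v}] Z) :=
  CartesianMonoidalCategory.lift a b ≫ eComp SSet.{v} X Y Z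

lemma lift_comp_tensorHom_eComp {K L L' : SSet.{v}} {X Y Z : C} (s : K ⟶ L) (t : K ⟶ L')
    (a : L ⟶ (X ⟶[SSet.{v}] Y)) (b : L' ⟶ (Y ⟶[SSet.{v}] Z)) :
    CartesianMonoidalCategory.lift s t ≫ (a ⊗ₘ b) ≫ eComp SSet.{v} X Y Z =
      pcomp (s ≫ a) (t ≫ b) := by
  rw [pcomp, CartesianMonoidalCategory.lift_map_assoc]

lemma constMap_pcomp {K : SSet.{v}} {X Y Z : C} (f : X ⟶ Y) (b : K ⟶ (Y ⟶[SSet.{v}] Z)) :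
    pcomp (constMap K f) b = b ≫ eHomWhiskerRight SSet.{v} f Z := by
  have h := congrArg (CartesianMonoidalCategory.lift (𝟙 K) (𝟙 K) ≫ ·)
    (constMap_tensorHom_eComp (K := K) f b)
  simpa only [lift_comp_tensorHom_eComp, Category.id_comp,
    CartesianMonoidalCategory.lift_snd_assoc] using h

lemma pcomp_whiskerLeft {K : SSet.{v}} {X Y Z Z' : C} (a : K ⟶ (X ⟶[SSet.{v}] Y))
    (b : K ⟶ (Y ⟶[SSet.{v}] Z)) (g : Z ⟶ Z') :
    pcomp a b ≫ eHomWhiskerLeft SSet.{v} X g = pcomp a (b ≫ eHomWhiskerLeft SSet.{v} Y g) := by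
  rw [pcomp, pcomp, Category.assoc, eComp_eHomWhiskerLeft, ← MonoidalCategory.id_tensorHom,
    CartesianMonoidalCategory.lift_map_assoc, Category.comp_id]

lemma pcomp_whiskerRight {K : SSet.{v}} {X X' Y Z : C} (a : K ⟶ (X ⟶[SSet.{v}] Y))
    (b : K ⟶ (Y ⟶[SSet.{v}] Z)) (f : X' ⟶ X) :
    pcomp a b ≫ eHomWhiskerRight SSet.{v} f Z = pcomp (a ≫ eHomWhiskerRight SSet.{v} f Y) b := by
  rw [pcomp, pcomp, Category.assoc, eComp_eHomWhiskerRight, ← MonoidalCategory.tensorHom_id,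
    CartesianMonoidalCategory.lift_map_assoc, Category.comp_id]

lemma whiskerLeft_pcomp {K : SSet.{v}} {X Y Y' Z : C} (a : K ⟶ (X ⟶[SSet.{v}] Y)) (g : Y ⟶ Y')
    (b : K ⟶ (Y' ⟶[SSet.{v}] Z)) :
    pcomp (a ≫ eHomWhiskerLeft SSet.{v} X g) b = pcomp a (b ≫ eHomWhiskerRight SSet.{v} g Z) := by
  have h := congrArg (CartesianMonoidalCategory.lift (𝟙 K) (𝟙 K) ≫ ·)
    (whiskerLeft_tensorHom_eComp g a b)
  simpa only [lift_comp_tensorHom_eComp, Category.id_comp] using h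

end PointwiseComp

/-! ### The universal property of a totalization, simplex by simplex -/

namespace Totalization

variable {C : Type u₁} [Category.{v} C] [SimplicialCategory C] {𝒳 : CosimplicialObject C}
  (TX : Totalization 𝒳)

lemma pcomp_map_π {A : C} {m n : SimplexCategory} (a : SSet.stdSimplex.obj m ⟶ (A ⟶[SSet.{v}] TX.pt))
    (θ : m ⟶ n) : pcomp a (SSet.stdSimplex.map θ ≫ TX.π n) =
      pcomp a (TX.π m) ≫ eHomWhiskerLeft SSet.{v} A (𝒳.map θ) := by
  rw [pcomp_whiskerLeft]
  exact congrArg (pcomp a) (TX.w θ)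

/-- Families of maps to a totalization are determined on simplices. -/
lemma family_ext {A : C} {K : SSet.{v}} {h h' : K ⟶ (A ⟶[SSet.{v}] TX.pt)}
    (e : ∀ (n : SimplexCategory) (y : SSet.stdSimplex.obj n ⟶ K),
      pcomp (y ≫ h) (TX.π n) = pcomp (y ≫ h') (TX.π n)) : h = h' := by
  refine (TX.existsUnique A K (fun n ↦ (h' ⊗ₘ TX.π n) ≫ eComp SSet.{v} A TX.pt (𝒳.obj n))
    ?_).unique (fun n ↦ ?_) (fun n ↦ rfl)
  · intro m n φ
    refine simplexwise_ext (fun k x ↦ ?_)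
    obtain ⟨y, t, rfl⟩ : ∃ y t, x = CartesianMonoidalCategory.lift y t :=
      ⟨_, _, (CartesianMonoidalCategory.lift_comp_fst_snd x).symm⟩
    rw [CartesianMonoidalCategory.lift_whiskerLeft_assoc, lift_comp_tensorHom_eComp,
      ← Category.assoc, Category.assoc, lift_comp_tensorHom_eComp, pcomp_whiskerLeft, Category.assoc]
    exact congrArg (fun z ↦ pcomp (y ≫ h') (t ≫ z)) (TX.w φ)
  · refine simplexwise_ext (fun k x ↦ ?_)
    obtain ⟨y, t, rfl⟩ : ∃ y t, x = CartesianMonoidalCategory.lift y t :=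
      ⟨_, _, (CartesianMonoidalCategory.lift_comp_fst_snd x).symm⟩
    rw [lift_comp_tensorHom_eComp, lift_comp_tensorHom_eComp, ← map_simplexHom t, pcomp_map_π,
      pcomp_map_π, e]

/-- A simplex of `K ⊗ Δ[n]` is a pair of a simplex `y` of `K` and an operator `θ`. Compatibility
with operators forces its image to be `g` of `y` followed by the action of `θ`. So it is enough to
prescribe the values at identity operators, subject to the condition `hg`. -/
lemma exists_family {A : C} {K : SSet.{v}}
    (g : ∀ n : SimplexCategory, (SSet.stdSimplex.obj n ⟶ K) →
      (SSet.stdSimplex.obj n ⟶ (A ⟶[SSet.{v}] 𝒳.obj n)))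
    (hg : ∀ {m n : SimplexCategory} (θ : m ⟶ n) (y : SSet.stdSimplex.obj n ⟶ K),
      SSet.stdSimplex.map θ ≫ g n y =
        g m (SSet.stdSimplex.map θ ≫ y) ≫ eHomWhiskerLeft SSet.{v} A (𝒳.map θ)) :
    ∃ h : K ⟶ (A ⟶[SSet.{v}] TX.pt), ∀ n y, pcomp (y ≫ h) (TX.π n) = g n y := by
  have hs (n : SimplexCategory) := exists_simplexwise (X := K ⊗ SSet.stdSimplex.obj n)
    (fun k x ↦ g k (x ≫ CartesianMonoidalCategory.fst _ _) ≫ eHomWhiskerLeft SSet.{v} A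
      (𝒳.map (simplexHom (x ≫ CartesianMonoidalCategory.snd _ _)))) (by
      intro k l θ x
      rw [reassoc_of% hg, Category.assoc, Category.assoc, simplexHom_map_comp,
        whiskerLeft_map_comp])
  choose s hs using hs
  obtain ⟨h, hh, -⟩ := TX.existsUnique A K s (by
    intro m n φ
    refine simplexwise_ext (fun k x ↦ ?_)
    have : 𝒳.map (simplexHom ((x ≫ K ◁ SSet.stdSimplex.map φ) ≫
        CartesianMonoidalCategory.snd _ _)) =
        𝒳.map (simplexHom (x ≫ CartesianMonoidalCategory.snd _ _) ≫ φ) := by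
      refine congrArg (𝒳.map ·) (SSet.stdSimplex.{v}.map_injective ?_)
      refine (map_simplexHom _).trans (Eq.trans ?_ (SSet.stdSimplex.map_comp _ _).symm)
      rw [map_simplexHom, Category.assoc, CartesianMonoidalCategory.whiskerLeft_snd]
      exact (Category.assoc _ _ _).symm
    rw [← Category.assoc, hs, ← Category.assoc, hs, this, Category.assoc, Category.assoc,
      whiskerLeft_map_comp, CartesianMonoidalCategory.whiskerLeft_fst])
  refine ⟨h, fun n y ↦ ?_⟩
  have := CartesianMonoidalCategory.lift y (𝟙 _) ≫= hh n
  rw [hs, lift_comp_tensorHom_eComp, Category.id_comp, CartesianMonoidalCategory.lift_fst,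
    CartesianMonoidalCategory.lift_snd] at this
  rw [← this]
  have h₁ : simplexHom (𝟙 (SSet.stdSimplex.{v}.obj n)) = 𝟙 n :=
    (congrArg simplexHom (SSet.stdSimplex.map_id n)).symm.trans (simplexHom_map (𝟙 n))
  rw [h₁]
  refine (congrArg (fun z ↦ g n y ≫ eHomWhiskerLeft SSet.{v} A z) (𝒳.map_id n)).trans ?_
  rw [eHomWhiskerLeft_id, Category.comp_id]

end Totalization

/-! ### Collapsing outer copies of `UG` by the counit -/

section Collapse

variable {M : Type u₁} [Category.{v} M] [SimplicialCategory M]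
  {N : Type u₂} [Category.{v} N] [SimplicialCategory N]
  {U : EnrichedFunctor SSet.{v} M N} {G : EnrichedFunctor SSet.{v} N M}
  (aG : SimplicialAdjunction U G)

/-- The image under `U` of the unit at an iterate. -/
def vη (X : M) (n : ℕ) : V aG X n ⟶ V aG X (n + 1) := umap U (iterUnit aG.adj.toMonad X n)

/-- The image under `U` of the map between iterates attached to a monotone map. -/
def vC (X : M) (m n : ℕ) (φ : Fin m →o Fin n) : V aG X m ⟶ V aG X n :=
  umap U (iterMap aG.adj.toMonad X m n φ)

lemma vη_vε (X : M) (n : ℕ) : vη aG X n ≫ vε aG X n = 𝟙 _ := aG.left_triangle _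

lemma vC_zero_zero (X : M) (φ : Fin 0 →o Fin 0) : vC aG X 0 0 φ = 𝟙 _ := by
  rw [vC, iterMap_zero_zero]
  exact umap_id _ _

lemma vC_zero_succ (X : M) (n : ℕ) (φ : Fin 0 →o Fin (n + 1)) :
    vC aG X 0 (n + 1) φ = vC aG X 0 n (emptyMap n) ≫ vη aG X n := by
  rw [vC, iterMap_zero_succ]
  exact umap_comp _ _ _

lemma vC_of_eq (X : M) {m n : ℕ} (φ : Fin (m + 1) →o Fin (n + 1))
    (h : φ (Fin.last m) = Fin.last n) :
    vC aG X (m + 1) (n + 1) φ = vmap aG (vC aG X m (n + 1) (init φ)) ≫ vmap aG (vε aG X n) := by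
  rw [vC, iterMap_of_eq _ _ _ h]
  exact umap_comp _ _ _

lemma vC_of_ne (X : M) {m n : ℕ} (φ : Fin (m + 1) →o Fin (n + 1))
    (h : φ (Fin.last m) ≠ Fin.last n) :
    vC aG X (m + 1) (n + 1) φ = vC aG X (m + 1) n (corestrict φ h) ≫ vη aG X n := by
  rw [vC, iterMap_of_ne _ _ _ h]
  exact umap_comp _ _ _

lemma vη_vC (X : M) {n k : ℕ} (ψ : Fin (n + 1) →o Fin (k + 1))
    (hψ : ψ (Fin.last n) = Fin.last k) :
    vη aG X n ≫ vC aG X (n + 1) (k + 1) ψ = vC aG X n (k + 1) (init ψ) :=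
  (umap_comp U _ _).symm.trans (congrArg (umap U) (iterUnit_iterMap aG.adj.toMonad X ψ hψ))

lemma vη_naturality {X Y : M} (f : X ⟶ Y) (n : ℕ) :
    vη aG X n ≫ vf aG f (n + 1) = vf aG f n ≫ vη aG Y n :=
  (umap_comp U _ _).symm.trans ((congrArg (umap U)
    (iterUnit_naturality aG.adj.toMonad (iterHom aG.adj.toMonad f n))).trans (umap_comp U _ _))

/-- The iterated counit `(U G)^n U X ⟶ U X`. -/
def kill (X : M) (n : ℕ) : V aG X n ⟶ V aG X 0 :=
  match n with
  | 0 => 𝟙 _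
  | n + 1 => vε aG X n ≫ kill X n

lemma kill_succ (X : M) (n : ℕ) : kill aG X (n + 1) = vε aG X n ≫ kill aG X n := rfl

/-- A unit inserted by `φ` cancels against a counit, and after a multiplication, itself a counit
inside `UG`, naturality reorders the counits. This makes the iterated counits an extra augmentation.
-/
lemma vC_kill (X : M) (m n : ℕ) (φ : Fin m →o Fin n) :
    vC aG X m n φ ≫ kill aG X n = kill aG X m := by
  match m, n, φ with
  | 0, 0, φ => rw [vC_zero_zero, Category.id_comp]
  | 0, n + 1, φ =>
    rw [vC_zero_succ, kill_succ, Category.assoc, reassoc_of% vη_vε aG X n, vC_kill]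
  | _ + 1, 0, φ => exact (φ 0).elim0
  | m + 1, n + 1, φ =>
    by_cases h : φ (Fin.last m) = Fin.last n
    · have ih := vC_kill X m (n + 1) (init φ)
      rw [kill_succ] at ih
      rw [vC_of_eq _ _ _ h, kill_succ, kill_succ, ← ih, Category.assoc,
        reassoc_of% vε_naturality aG (vε aG X n),
        reassoc_of% vε_naturality aG (vC aG X m (n + 1) (init φ))]
    · rw [vC_of_ne _ _ _ h, kill_succ, Category.assoc, reassoc_of% vη_vε aG X n, vC_kill]
termination_by (m, n)

lemma kill_naturality {X Y : M} (f : X ⟶ Y) (n : ℕ) :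
    kill aG X n ≫ vf aG f 0 = vf aG f n ≫ kill aG Y n := by
  induction n with
  | zero => rw [kill, kill, Category.id_comp, Category.comp_id]
  | succ n ih =>
    rw [kill_succ, kill_succ, Category.assoc, ih, vf_succ, reassoc_of% vε_naturality aG (vf aG f n)]

/-- The endomorphism of `(U G)^n U X` which applies the counit to the outermost copies of `U G`, on
which `β` takes the value `1`, and inserts them again by the unit. -/
def collapse (X : M) (n : ℕ) (β : Fin n →o Fin 2) : V aG X n ⟶ V aG X n :=
  match n, β with
  | 0, _ => 𝟙 _
  | n + 1, β => if β (Fin.last n) = 0 then 𝟙 _ else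
      vε aG X n ≫ collapse X n (init β) ≫ vη aG X n

lemma collapse_zero (X : M) (β : Fin 0 →o Fin 2) : collapse aG X 0 β = 𝟙 _ := rfl

lemma collapse_of_eq (X : M) {n : ℕ} (β : Fin (n + 1) →o Fin 2) (h : β (Fin.last n) = 0) :
    collapse aG X (n + 1) β = 𝟙 _ := if_pos h

lemma collapse_of_ne (X : M) {n : ℕ} (β : Fin (n + 1) →o Fin 2) (h : β (Fin.last n) ≠ 0) :
    collapse aG X (n + 1) β = vε aG X n ≫ collapse aG X n (init β) ≫ vη aG X n := if_neg h

/-- The copies collapsed before `φ` are those that `φ` sends to collapsed ones. The induction peels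
off the outermost copy as in the definition of `iterMap`, using naturality of the counit and its
cancellation against the unit. This is the identity that makes the collapses a simplicial homotopy.
-/
lemma vC_collapse (X : M) (m n : ℕ) (φ : Fin m →o Fin n) (β : Fin n →o Fin 2) :
    vC aG X m n φ ≫ collapse aG X n β = collapse aG X m (β.comp φ) ≫ vC aG X m n φ := by
  match m, n, φ, β with
  | 0, 0, φ, β => rw [collapse_zero, collapse_zero, Category.id_comp, Category.comp_id]
  | 0, n + 1, φ, β =>
    by_cases hβ : β (Fin.last n) = 0
    · rw [collapse_of_eq _ _ _ hβ, collapse_zero, Category.id_comp, Category.comp_id]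
    · have ih := vC_collapse X 0 n (emptyMap n) (init β)
      rw [collapse_zero, Category.id_comp] at ih
      rw [collapse_of_ne _ _ _ hβ, collapse_zero, Category.id_comp, vC_zero_succ, Category.assoc,
        reassoc_of% vη_vε aG X n, reassoc_of% ih]
  | _ + 1, 0, φ, β => exact (φ 0).elim0
  | m + 1, n + 1, φ, β =>
    by_cases hβ : β (Fin.last n) = 0
    · have hφ : (β.comp φ) (Fin.last m) = 0 :=
        le_antisymm (hβ ▸ β.monotone (Fin.le_last _)) (Fin.zero_le _)
      rw [collapse_of_eq _ _ _ hβ, collapse_of_eq _ _ _ hφ, Category.id_comp, Category.comp_id]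
    by_cases h : φ (Fin.last m) = Fin.last n
    · have ih := vC_collapse X m (n + 1) (init φ) β
      have hφ : (β.comp φ) (Fin.last m) ≠ 0 := by simpa [h] using hβ
      rw [collapse_of_ne _ _ _ hβ] at ih
      rw [collapse_of_ne _ _ _ hφ, collapse_of_ne _ _ _ hβ, Category.assoc, Category.assoc,
        vη_vC _ _ _ h, vC_of_eq _ _ _ h, Category.assoc,
        reassoc_of% vε_naturality aG (vε aG X n),
        reassoc_of% vε_naturality aG (vC aG X m (n + 1) (init φ)), ih]
      rfl
    · have ih := vC_collapse X (m + 1) n (corestrict φ h) (init β)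
      rw [collapse_of_ne _ _ _ hβ, vC_of_ne _ _ _ h, Category.assoc, reassoc_of% vη_vε aG X n,
        reassoc_of% ih]
      rfl
termination_by (m, n)

lemma collapse_naturality {X Y : M} (f : X ⟶ Y) (n : ℕ) (β : Fin n →o Fin 2) :
    collapse aG X n β ≫ vf aG f n = vf aG f n ≫ collapse aG Y n β := by
  induction n with
  | zero => rw [collapse_zero, collapse_zero, Category.id_comp, Category.comp_id]
  | succ n ih =>
    by_cases hβ : β (Fin.last n) = 0
    · rw [collapse_of_eq _ _ _ hβ, collapse_of_eq _ _ _ hβ, Category.id_comp, Category.comp_id]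
    · rw [collapse_of_ne _ _ _ hβ, collapse_of_ne _ _ _ hβ, Category.assoc, Category.assoc,
        vη_naturality, reassoc_of% ih (init β), vf_succ,
        reassoc_of% vε_naturality aG (vf aG f n)]

lemma collapse_eq_id (X : M) {n : ℕ} {β : Fin n →o Fin 2} (hβ : ∀ i, β i = 0) :
    collapse aG X n β = 𝟙 _ := by
  cases n with
  | zero => rfl
  | succ n => exact collapse_of_eq _ _ _ (hβ _)

lemma collapse_eq_kill (X : M) {n : ℕ} {β : Fin n →o Fin 2} (hβ : ∀ i, β i = 1) :
    collapse aG X n β = kill aG X n ≫ vC aG X 0 n (emptyMap n) := by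
  induction n with
  | zero => rw [vC_zero_zero, Category.comp_id]; rfl
  | succ n ih =>
    rw [collapse_of_ne _ _ _ (by rw [hβ]; exact one_ne_zero), ih (β := init β) (fun i ↦ hβ _),
      vC_zero_succ, kill_succ, Category.assoc, Category.assoc]

end Collapse

/-! ### The deformation retraction of `U` of the cobar construction -/

section Deformation

variable {M : Type u₁} [Category.{v} M] [SimplicialCategory M]
  {N : Type u₂} [Category.{v} N] [SimplicialCategory N]
  {U : EnrichedFunctor SSet.{v} M N} {F G : EnrichedFunctor SSet.{v} N M}
  (aF : SimplicialAdjunction F U) (aG : SimplicialAdjunction U G)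
  (Tot : ∀ X : M, Totalization (cobar aG.adj.toMonad X))

/-- The image under `U` of the universal cosimplicial map. -/
def vπ (X : M) (n : SimplexCategory) :
    SSet.stdSimplex.obj n ⟶ (U.obj (Tot X).pt ⟶[SSet.{v}] V aG X (n.len + 1)) :=
  (Tot X).π n ≫ U.map _ _

lemma map_vπ (X : M) {m n : SimplexCategory} (θ : m ⟶ n) :
    SSet.stdSimplex.map θ ≫ vπ aG Tot X n =
      vπ aG Tot X m ≫ eHomWhiskerLeft SSet.{v} _ (vC aG X _ _ θ.toOrderHom) := by
  have h := whiskerLeft_map U (Tot X).pt ((cobar aG.adj.toMonad X).map θ)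
  calc _ = (SSet.stdSimplex.map θ ≫ (Tot X).π n) ≫ U.map _ _ := (Category.assoc _ _ _).symm
    _ = ((Tot X).π m ≫ eHomWhiskerLeft SSet.{v} _ ((cobar aG.adj.toMonad X).map θ)) ≫ U.map _ _ :=
      congrArg (· ≫ U.map _ _) ((Tot X).w θ)
    _ = (Tot X).π m ≫ U.map _ _ ≫ eHomWhiskerLeft SSet.{v} _
        (umap U ((cobar aG.adj.toMonad X).map θ)) := (Category.assoc _ _ _).trans (congrArg _ h)
    _ = _ := (Category.assoc _ _ _).symm

/-- The image under `U` of the coaugmentation of the cobar construction. -/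
def vnu (X : M) : V aG X 0 ⟶ U.obj (Tot X).pt := umap U (nu aG.adj.toMonad Tot X)

lemma vπ_nu (X : M) (n : SimplexCategory) :
    vπ aG Tot X n ≫ eHomWhiskerRight SSet.{v} (vnu aG Tot X) _ =
      constMap _ (vC aG X 0 (n.len + 1) (emptyMap _)) := by
  have h := whiskerRight_map U (nu aG.adj.toMonad Tot X) ((cobar aG.adj.toMonad X).obj n)
  calc _ = (Tot X).π n ≫ U.map _ _ ≫ eHomWhiskerRight SSet.{v} _ _ := Category.assoc _ _ _
    _ = ((Tot X).π n ≫ eHomWhiskerRight SSet.{v} (nu aG.adj.toMonad Tot X) _) ≫ U.map _ _ :=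
      (congrArg _ h.symm).trans (Category.assoc _ _ _).symm
    _ = constMap _ (cobarCoaug aG.adj.toMonad X n) ≫ U.map _ _ :=
      congrArg (· ≫ U.map _ _) (nu_fac aG.adj.toMonad Tot X n)
    _ = _ := constMap_map U _ _

lemma vπ_totMap {X Y : M} (f : X ⟶ Y) (n : SimplexCategory) :
    vπ aG Tot Y n ≫ eHomWhiskerRight SSet.{v} (umap U (totMap aG.adj.toMonad Tot f)) _ =
      vπ aG Tot X n ≫ eHomWhiskerLeft SSet.{v} _ (vf aG f (n.len + 1)) := by
  have h := whiskerRight_map U (totMap aG.adj.toMonad Tot f) ((cobar aG.adj.toMonad Y).obj n)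
  have h' := whiskerLeft_map U (Tot X).pt ((cobarMap aG.adj.toMonad f).app n)
  calc _ = (Tot Y).π n ≫ U.map _ _ ≫ eHomWhiskerRight SSet.{v} _ _ := Category.assoc _ _ _
    _ = ((Tot Y).π n ≫ eHomWhiskerRight SSet.{v} (totMap aG.adj.toMonad Tot f) _) ≫ U.map _ _ :=
      (congrArg _ h.symm).trans (Category.assoc _ _ _).symm
    _ = ((Tot X).π n ≫ eHomWhiskerLeft SSet.{v} _ ((cobarMap aG.adj.toMonad f).app n)) ≫
        U.map _ _ := congrArg (· ≫ U.map _ _) (totMap_fac aG.adj.toMonad Tot f n)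
    _ = (Tot X).π n ≫ U.map _ _ ≫ eHomWhiskerLeft SSet.{v} _
        (umap U ((cobarMap aG.adj.toMonad f).app n)) :=
      (Category.assoc _ _ _).trans (congrArg _ h')
    _ = _ := (Category.assoc _ _ _).symm

/-- The isomorphism for `F ⊣ U` takes composition with the universal family to composition with its
image under `U`, so that the universal property of the totalization transfers to `N`. -/
lemma pcomp_homIso {X : M} {A : N} {n : SimplexCategory}
    (h : SSet.stdSimplex.obj n ⟶ (F.obj A ⟶[SSet.{v}] (Tot X).pt)) :
    pcomp (h ≫ (aF.homIso A (Tot X).pt).hom) (vπ aG Tot X n) =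
      pcomp h ((Tot X).π n) ≫ (aF.homIso A ((cobar aG.adj.toMonad X).obj n)).hom := by
  have e := CartesianMonoidalCategory.lift h ((Tot X).π n) ≫=
    aF.eComp_homIso_hom A (Tot X).pt ((cobar aG.adj.toMonad X).obj n)
  rw [CartesianMonoidalCategory.lift_map_assoc] at e
  exact e.symm.trans (Category.assoc _ _ _).symm

include aF in
/-- Families of maps to the image under `U` of the cobar construction are determined on
simplices. -/
lemma vπ_family_ext {X : M} {A : N} {K : SSet.{v}} {h h' : K ⟶ (A ⟶[SSet.{v}] U.obj (Tot X).pt)}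
    (e : ∀ (n : SimplexCategory) (y : SSet.stdSimplex.obj n ⟶ K),
      pcomp (y ≫ h) (vπ aG Tot X n) = pcomp (y ≫ h') (vπ aG Tot X n)) : h = h' := by
  obtain ⟨h, rfl⟩ : ∃ k, h = k ≫ (aF.homIso A (Tot X).pt).hom :=
    ⟨h ≫ (aF.homIso A (Tot X).pt).inv, by rw [Category.assoc, Iso.inv_hom_id, Category.comp_id]⟩
  obtain ⟨h', rfl⟩ : ∃ k, h' = k ≫ (aF.homIso A (Tot X).pt).hom :=
    ⟨h' ≫ (aF.homIso A (Tot X).pt).inv, by rw [Category.assoc, Iso.inv_hom_id, Category.comp_id]⟩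
  congr 1
  refine (Tot X).family_ext (fun n y ↦ ?_)
  have := e n y
  rw [← Category.assoc, ← Category.assoc, pcomp_homIso, pcomp_homIso] at this
  exact (cancel_mono _).1 this

include aF in
lemma exists_vπ_family {X : M} {A : N} {K : SSet.{v}}
    (g : ∀ n : SimplexCategory, (SSet.stdSimplex.obj n ⟶ K) →
      (SSet.stdSimplex.obj n ⟶ (A ⟶[SSet.{v}] V aG X (n.len + 1))))
    (hg : ∀ {m n : SimplexCategory} (θ : m ⟶ n) (y : SSet.stdSimplex.obj n ⟶ K),
      SSet.stdSimplex.map θ ≫ g n y = g m (SSet.stdSimplex.map θ ≫ y) ≫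
        eHomWhiskerLeft SSet.{v} A (vC aG X _ _ θ.toOrderHom)) :
    ∃ h : K ⟶ (A ⟶[SSet.{v}] U.obj (Tot X).pt), ∀ n y, pcomp (y ≫ h) (vπ aG Tot X n) = g n y := by
  obtain ⟨h, hh⟩ := (Tot X).exists_family
    (fun n y ↦ g n y ≫ (aF.homIso A ((cobar aG.adj.toMonad X).obj n)).inv) (by
      intro m n θ y
      have h' := aF.whiskerLeft_homIso_inv A ((cobar aG.adj.toMonad X).map θ)
      refine (Category.assoc _ _ _).symm.trans (Eq.trans ?_ (Category.assoc _ _ _).symm)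
      refine (congrArg (· ≫ (aF.homIso A ((cobar aG.adj.toMonad X).obj n)).inv) (hg θ y)).trans ?_
      exact (Category.assoc _ _ _).trans (congrArg _ h'))
  refine ⟨h ≫ (aF.homIso A (Tot X).pt).hom, fun n y ↦ ?_⟩
  rw [← Category.assoc, pcomp_homIso, hh]
  exact (Category.assoc _ _ _).trans ((congrArg _ (Iso.inv_hom_id _)).trans (Category.comp_id _))

lemma pcomp_const_vπ {X : M} {A : N} (n : SimplexCategory) (t : A ⟶ U.obj (Tot X).pt) :
    pcomp (constMap _ t) (vπ aG Tot X n) = vπ aG Tot X n ≫ eHomWhiskerRight SSet.{v} t _ :=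
  constMap_pcomp _ _

/-- The value of a map to `Δ[1]`, as a monotone map. -/
def vertexMap {n : SimplexCategory} (y : SSet.stdSimplex.{v}.obj n ⟶ Δ[1]) :
    Fin (n.len + 1) →o Fin 2 :=
  (simplexHom y).toOrderHom

lemma vertexMap_map_comp {m n : SimplexCategory} (θ : m ⟶ n)
    (y : SSet.stdSimplex.{v}.obj n ⟶ Δ[1]) :
    vertexMap (SSet.stdSimplex.map θ ≫ y) = (vertexMap y).comp θ.toOrderHom := by
  rw [vertexMap, simplexHom_map_comp]
  rfl

lemma vertexMap_comp_map {n : SimplexCategory} (y : SSet.stdSimplex.{v}.obj n ⟶ Δ[0])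
    (θ : ⦋0⦌ ⟶ ⦋1⦌) (i : Fin (n.len + 1)) :
    vertexMap (y ≫ SSet.stdSimplex.map θ) i = θ.toOrderHom 0 := by
  rw [← map_simplexHom y, vertexMap, simplexHom_map_comp, simplexHom_map]
  exact congrArg θ.toOrderHom (Subsingleton.elim (α := Fin 1) _ _)

include aF in
/-- The homotopy given by collapsing the outermost copies of `U G`. -/
lemma exists_collapse_homotopy (X : M) :
    ∃ H : Δ[1] ⟶ (U.obj (Tot X).pt ⟶[SSet.{v}] U.obj (Tot X).pt), ∀ n y,
      pcomp (y ≫ H) (vπ aG Tot X n) =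
        vπ aG Tot X n ≫ eHomWhiskerLeft SSet.{v} _ (collapse aG X (n.len + 1) (vertexMap y)) :=
  exists_vπ_family aF aG Tot
    (fun n y ↦ vπ aG Tot X n ≫ eHomWhiskerLeft SSet.{v} _ (collapse aG X _ (vertexMap y)))
    (fun {m n} θ y ↦ by
      rw [← Category.assoc, map_vπ, Category.assoc, Category.assoc, ← eHomWhiskerLeft_comp,
        ← eHomWhiskerLeft_comp, vC_collapse, vertexMap_map_comp])

/-- The homotopy on the image under `U` of the cobar construction. -/
def cobarHomotopy (X : M) : Δ[1] ⟶ (U.obj (Tot X).pt ⟶[SSet.{v}] U.obj (Tot X).pt) :=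
  (exists_collapse_homotopy aF aG Tot X).choose

lemma pcomp_cobarHomotopy (X : M) {n : SimplexCategory} (y : SSet.stdSimplex.obj n ⟶ Δ[1]) :
    pcomp (y ≫ cobarHomotopy aF aG Tot X) (vπ aG Tot X n) =
      vπ aG Tot X n ≫ eHomWhiskerLeft SSet.{v} _ (collapse aG X (n.len + 1) (vertexMap y)) :=
  (exists_collapse_homotopy aF aG Tot X).choose_spec n y

/-- The retraction of the image under `U` of the coaugmentation of the cobar construction. -/
lemma exists_cobarRetraction (X : M) : ∃ r : U.obj (Tot X).pt ⟶ V aG X 0,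
    ∀ n, vπ aG Tot X n ≫ eHomWhiskerLeft SSet.{v} _ (kill aG X (n.len + 1)) = constMap _ r := by
  obtain ⟨r, hr⟩ := exists_eq_constMap SSet.stdSimplex.isTerminalObj₀
    (vπ aG Tot X ⦋0⦌ ≫ eHomWhiskerLeft SSet.{v} _ (kill aG X 1))
  refine ⟨r, fun n ↦ ?_⟩
  -- Iterated counits absorb cosimplicial operators, so degree `n` is compared with degree zero
  -- through the terminal map.
  let θ : n ⟶ ⦋0⦌ := SimplexCategory.isTerminalZero.from n
  have h := vC_kill aG X _ _ θ.toOrderHom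
  rw [← h, eHomWhiskerLeft_comp, ← Category.assoc, ← map_vπ, Category.assoc]
  exact (congrArg (SSet.stdSimplex.map θ ≫ ·) hr).trans (Totalization.comp_constMap _ _)

/-- The retraction of the image under `U` of the coaugmentation of the cobar construction. -/
def cobarRetraction (X : M) : U.obj (Tot X).pt ⟶ V aG X 0 :=
  (exists_cobarRetraction aG Tot X).choose

lemma vπ_kill (X : M) (n : SimplexCategory) :
    vπ aG Tot X n ≫ eHomWhiskerLeft SSet.{v} _ (kill aG X (n.len + 1)) =
      constMap _ (cobarRetraction aG Tot X) :=
  (exists_cobarRetraction aG Tot X).choose_spec n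

lemma nu_cobarRetraction (X : M) :
    vnu aG Tot X ≫ cobarRetraction aG Tot X = 𝟙 _ := by
  have h (n : SimplexCategory) : constMap (SSet.stdSimplex.obj n)
      (vnu aG Tot X ≫ cobarRetraction aG Tot X) =
        constMap (SSet.stdSimplex.obj n) (kill aG X 0) := by
    rw [← vC_kill aG X 0 (n.len + 1) (emptyMap _),
      ← Totalization.constMap_comp_whiskerLeft _ _ (kill aG X (n.len + 1)), ← vπ_nu,
      Category.assoc, ← eHom_whisker_exchange, ← Category.assoc, vπ_kill]
    exact (Totalization.constMap_comp_whiskerRight _ _ _).symm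
  exact constMap_injective (SSet.stdSimplex.isTerminalObj₀.from _) (h ⦋0⦌)

lemma cobarRetraction_naturality {X Y : M} (f : X ⟶ Y) :
    umap U (totMap aG.adj.toMonad Tot f) ≫ cobarRetraction aG Tot Y =
      cobarRetraction aG Tot X ≫ vf aG f 0 := by
  have h (n : SimplexCategory) : constMap (SSet.stdSimplex.obj n)
      (umap U (totMap aG.adj.toMonad Tot f) ≫ cobarRetraction aG Tot Y) =
        constMap (SSet.stdSimplex.obj n) (cobarRetraction aG Tot X ≫ vf aG f 0) := by
    rw [← Totalization.constMap_comp_whiskerRight,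
      ← Totalization.constMap_comp_whiskerLeft, ← vπ_kill, ← vπ_kill,
      Category.assoc, Category.assoc, eHom_whisker_exchange, ← Category.assoc, vπ_totMap,
      Category.assoc, ← eHomWhiskerLeft_comp, ← eHomWhiskerLeft_comp, kill_naturality]
  exact constMap_injective (SSet.stdSimplex.isTerminalObj₀.from _) (h ⦋0⦌)

lemma δ_one_cobarHomotopy (X : M) :
    SSet.stdSimplex.map (SimplexCategory.δ (1 : Fin 2)) ≫ cobarHomotopy aF aG Tot X =
      constMap _ (𝟙 _) := by
  refine vπ_family_ext aF aG Tot (fun n y ↦ ?_)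
  rw [Totalization.comp_constMap, ← Category.assoc, pcomp_cobarHomotopy, pcomp_const_vπ,
    -- The coface omitting `1` is the vertex `0`, where nothing is collapsed.
    collapse_eq_id _ _ (fun i ↦ vertexMap_comp_map _ _ _), eHomWhiskerLeft_id, eHomWhiskerRight_id]

lemma δ_zero_cobarHomotopy (X : M) :
    SSet.stdSimplex.map (SimplexCategory.δ (0 : Fin 2)) ≫ cobarHomotopy aF aG Tot X =
      constMap _ (cobarRetraction aG Tot X ≫ vnu aG Tot X) := by
  refine vπ_family_ext aF aG Tot (fun n y ↦ ?_)
  rw [Totalization.comp_constMap, ← Category.assoc, pcomp_cobarHomotopy, pcomp_const_vπ,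
    -- At the vertex `1` everything is collapsed: the iterated counit followed by the
    -- coaugmentation.
    collapse_eq_kill _ _ (fun i ↦ vertexMap_comp_map _ _ _), eHomWhiskerLeft_comp,
    eHomWhiskerRight_comp, ← Category.assoc, ← Category.assoc, vπ_kill, vπ_nu,
    Totalization.constMap_comp_whiskerRight, Totalization.constMap_comp_whiskerLeft]

/-- The coaugmentation comes from the empty ordinal, where there is no copy of `UG` to collapse. -/
lemma cobarHomotopy_nu (X : M) :
    cobarHomotopy aF aG Tot X ≫
        eHomWhiskerRight SSet.{v} (vnu aG Tot X) _ =
      constMap _ (vnu aG Tot X) := by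
  refine vπ_family_ext aF aG Tot (fun n y ↦ ?_)
  rw [Totalization.comp_constMap, ← Category.assoc, ← pcomp_whiskerRight, pcomp_cobarHomotopy,
    pcomp_const_vπ, Category.assoc, eHom_whisker_exchange, ← Category.assoc, vπ_nu,
    Totalization.constMap_comp_whiskerLeft, vC_collapse, collapse_zero, Category.id_comp]

lemma cobarHomotopy_naturality {X Y : M} (f : X ⟶ Y) :
    cobarHomotopy aF aG Tot X ≫
        eHomWhiskerLeft SSet.{v} _ (umap U (totMap aG.adj.toMonad Tot f)) =
      cobarHomotopy aF aG Tot Y ≫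
        eHomWhiskerRight SSet.{v} (umap U (totMap aG.adj.toMonad Tot f)) _ := by
  refine vπ_family_ext aF aG Tot (fun n y ↦ ?_)
  rw [← Category.assoc, whiskerLeft_pcomp, vπ_totMap, ← pcomp_whiskerLeft, pcomp_cobarHomotopy,
    ← Category.assoc, ← pcomp_whiskerRight, pcomp_cobarHomotopy, Category.assoc,
    ← eHomWhiskerLeft_comp, collapse_naturality, Category.assoc, eHom_whisker_exchange,
    ← Category.assoc (vπ aG Tot Y n), vπ_totMap, Category.assoc, ← eHomWhiskerLeft_comp]

include aF in
/-- The image under `U` of the coaugmentation of the cobar construction is the inclusion of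
a simplicial strong deformation retract. -/
lemma isStrongDeformationRetract_nu (X : M) :
    IsStrongDeformationRetract (vnu aG Tot X) :=
  ⟨cobarRetraction aG Tot X, nu_cobarRetraction aG Tot X, cobarHomotopy aF aG Tot X,
    δ_one_cobarHomotopy aF aG Tot X, δ_zero_cobarHomotopy aF aG Tot X,
    cobarHomotopy_nu aF aG Tot X⟩

end Deformation

/-! ### The deformation retraction of the relative cobar construction -/

section RelativeDeformation

variable {M : Type u₁} [Category.{v} M] [SimplicialCategory M]
  {N : Type u₂} [Category.{v} N] [SimplicialCategory N]
  {U : EnrichedFunctor SSet.{v} M N} {F G : EnrichedFunctor SSet.{v} N M}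
  (aF : SimplicialAdjunction F U) (aG : SimplicialAdjunction U G)
  (Tot : ∀ X : M, Totalization (cobar aG.adj.toMonad X))

include aF in
lemma isPullback_umap {P X Y Z : M} {fst : P ⟶ X} {snd : P ⟶ Y} {f : X ⟶ Z} {g : Y ⟶ Z}
    (h : IsPullback fst snd f g) :
    IsPullback (umap U fst) (umap U snd) (umap U f) (umap U g) := by
  have : PreservesLimitsOfSize.{0, 0} (underlying U) := aF.adj.rightAdjoint_preservesLimits
  exact h.map (underlying U)

variable [HasPullbacks M]

include aF in
/-- The image under `U` of `λ_f` is the inclusion of a simplicial strong deformation retract. -/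
lemma isStrongDeformationRetract_lam (hN : HasCopowers N) {X Y : M} (f : X ⟶ Y) :
    IsStrongDeformationRetract (umap U (lam aG.adj.toMonad Tot f)) := by
  let E := U.obj (relCobar aG.adj.toMonad Tot f)
  let l : V aG X 0 ⟶ E := umap U (lam aG.adj.toMonad Tot f)
  let p : E ⟶ V aG Y 0 := umap U (rho aG.adj.toMonad Tot f)
  let q : E ⟶ U.obj (Tot X).pt := umap U (pullback.snd _ _)
  let t : U.obj (Tot X).pt ⟶ U.obj (Tot Y).pt := umap U (totMap aG.adj.toMonad Tot f)
  have hP : IsPullback p q (vnu aG Tot Y) t := isPullback_umap aF (IsPullback.of_hasPullback _ _)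
  have hlp : l ≫ p = vf aG f 0 :=
    (umap_comp U _ _).symm.trans (congrArg (umap U) (pullback.lift_fst _ _ _))
  have hlq : l ≫ q = vnu aG Tot X :=
    (umap_comp U _ _).symm.trans (congrArg (umap U) (pullback.lift_snd _ _ _))
  have hnat : cobarHomotopy aF aG Tot X ≫ eHomWhiskerLeft SSet.{v} _ t =
      cobarHomotopy aF aG Tot Y ≫ eHomWhiskerRight SSet.{v} t _ :=
    cobarHomotopy_naturality aF aG Tot f
  have hrt : t ≫ cobarRetraction aG Tot Y = cobarRetraction aG Tot X ≫ vf aG f 0 :=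
    cobarRetraction_naturality aG Tot f
  -- The homotopy is constant in the component `U Y` and is the cobar homotopy in the other. The
  -- components agree because the cobar homotopy is natural and is constant along the coaugmentation
  -- of `Y`.
  obtain ⟨H, hHp, hHq⟩ := IsPullback.eHom_exists hN hP E (constMap Δ[1] p)
    (cobarHomotopy aF aG Tot X ≫ eHomWhiskerRight SSet.{v} q _) (by
      rw [Category.assoc, ← eHom_whisker_exchange, ← Category.assoc, hnat,
        Category.assoc, ← eHomWhiskerRight_comp, ← hP.w, eHomWhiskerRight_comp, ← Category.assoc,
        cobarHomotopy_nu,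
        Totalization.constMap_comp_whiskerRight, Totalization.constMap_comp_whiskerLeft])
  have hr : q ≫ cobarRetraction aG Tot X ≫ l ≫ p = p := by
    rw [hlp, ← hrt, ← Category.assoc, ← hP.w, Category.assoc, nu_cobarRetraction, Category.comp_id]
  refine ⟨q ≫ cobarRetraction aG Tot X, ?_, H, ?_, ?_, ?_⟩
  · exact (Category.assoc _ _ _).symm.trans
      ((congrArg (· ≫ cobarRetraction aG Tot X) hlq).trans (nu_cobarRetraction aG Tot X))
  · refine IsPullback.eHom_ext hN hP ?_ ?_
    · rw [Category.assoc, hHp, Totalization.comp_constMap, Totalization.constMap_comp_whiskerLeft,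
        Category.id_comp]
    · rw [Category.assoc, hHq, ← Category.assoc, δ_one_cobarHomotopy,
        Totalization.constMap_comp_whiskerLeft, Totalization.constMap_comp_whiskerRight,
        Category.id_comp, Category.comp_id]
  · refine IsPullback.eHom_ext hN hP ?_ ?_
    · rw [Category.assoc, hHp, Totalization.comp_constMap, Totalization.constMap_comp_whiskerLeft]
      exact congrArg _ ((Category.assoc _ _ _).trans ((Category.assoc _ _ _).trans hr)).symm
    · rw [Category.assoc, hHq, ← Category.assoc, δ_zero_cobarHomotopy,
        Totalization.constMap_comp_whiskerLeft, Totalization.constMap_comp_whiskerRight, ← hlq]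
      exact congrArg _ ((Category.assoc _ _ _).trans (Category.assoc _ _ _)).symm
  · change H ≫ eHomWhiskerRight SSet.{v} l E = constMap _ l
    refine IsPullback.eHom_ext hN hP ?_ ?_
    · rw [Category.assoc, ← eHom_whisker_exchange, ← Category.assoc, hHp,
        Totalization.constMap_comp_whiskerLeft, Totalization.constMap_comp_whiskerRight]
    · rw [Category.assoc, ← eHom_whisker_exchange, ← Category.assoc, hHq, Category.assoc,
        ← eHomWhiskerRight_comp, hlq, cobarHomotopy_nu, Totalization.constMap_comp_whiskerLeft, hlq]

end RelativeDeformation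

/-! ### Injective fibrations -/

section Main

variable {M : Type u₁} [Category.{v} M] [SimplicialCategory M]
  {N : Type u₂} [Category.{v} N] [SimplicialCategory N] [ModelCategory N]
  {U : EnrichedFunctor SSet.{v} M N} {F G : EnrichedFunctor SSet.{v} N M}
  (aF : SimplicialAdjunction F U) (aG : SimplicialAdjunction U G)
  (Tot : ∀ X : M, Totalization (cobar aG.adj.toMonad X))

include aF in
/-- Injective fibrations are `U`-fibrations. -/
lemma uFibrations_of_injectiveFibrations (hG : QuillenCounitFibrant aG.adj.toComonad) {X Y : M}
    {f : X ⟶ Y} (hf : injectiveFibrations (underlying U) f) : uFibrations (underlying U) f := by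
  change fibrations N (umap U f)
  rw [← MorphismProperty.rlp_eq_of_wfs (trivialCofibrations N) (fibrations N)]
  -- Transposed along `F ⊣ U`, this is lifting of `F i`, which `U` sends to an acyclic cofibration.
  intro A B i hi
  exact (aF.adj.hasLiftingProperty_iff _ _).1 (hf (umap F i) (trivialCofibrations_umap_umap aF
    ((quillenCounitFibrant_iff_quillenUnitCofibrant aF aG).1 hG) hi))

variable [HasPullbacks M] [SimplicialModelCategory N]

include aF in
/-- A `U`-fibration `f`, for which `λ_f` has a retraction over the target, is an injective
fibration. -/
lemma injectiveFibrations_of_retraction (hG : QuillenCounitFibrant aG.adj.toComonad) {X Y : M}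
    {f : X ⟶ Y} (hf : uFibrations (underlying U) f) (r : relCobar aG.adj.toMonad Tot f ⟶ X)
    (hr : lam aG.adj.toMonad Tot f ≫ r = 𝟙 X) (hrf : r ≫ f = rho aG.adj.toMonad Tot f) :
    injectiveFibrations (underlying U) f := by
  have h : injectiveFibrations (underlying U) (totMap aG.adj.toMonad Tot f) :=
    injectiveFibrations_totMap aF aG
      ((quillenCounitFibrant_iff_quillenUnitCofibrant aF aG).1 hG) Tot f hf
  have h' : injectiveFibrations (underlying U) (rho aG.adj.toMonad Tot f) :=
    (uTrivialCofibrations (underlying U)).rlp.of_isPullback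
      (IsPullback.of_hasPullback (nu aG.adj.toMonad Tot Y) (totMap aG.adj.toMonad Tot f)).flip h
  -- The retraction exhibits `f` as a retract, over `Y`, of the injective fibration `ρ_f`.
  exact (uTrivialCofibrations (underlying U)).rlp.of_retract
    { i := Arrow.homMk (lam aG.adj.toMonad Tot f) (𝟙 Y)
        ((pullback.lift_fst _ _ _).trans (Category.comp_id f).symm)
      r := Arrow.homMk r (𝟙 Y) (hrf.trans (Category.comp_id _).symm)
      retract := by ext <;> simp [hr] } h'

end Main

end CobarInj

end

theorem mainTheorem3
    {M : Type u₁} [Category.{v} M] [SimplicialCategory M] [HasFiniteLimits M]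
    {N : Type u₂} [Category.{v} N] [SimplicialCategory N]
    [ModelCategory N] [SimplicialModelCategory N]
    (U : EnrichedFunctor SSet.{v} M N) (F G : EnrichedFunctor SSet.{v} N M)
    (adjF : SimplicialAdjunction F U) (adjG : SimplicialAdjunction U G)
    (Tot : ∀ X : M, Totalization (cobar adjG.adj.toMonad X)) :
    (QuillenCounitFibrant adjG.adj.toComonad ↔ QuillenUnitCofibrant adjF.adj.toMonad) ∧
    (QuillenCounitFibrant adjG.adj.toComonad →
      (∀ ⦃A B : N⦄ (i : A ⟶ B), IsStrongDeformationRetract i → cofibrations N i) →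
      (∀ ⦃A B : N⦄ (i : A ⟶ B), IsStrongDeformationRetract i → trivialCofibrations N i) ∧
      (∀ ⦃X Y : M⦄ (f : X ⟶ Y),
        injectiveFibrations (underlying U) f ↔
          uFibrations (underlying U) f ∧
            ∃ r : relCobar adjG.adj.toMonad Tot f ⟶ X,
              lam adjG.adj.toMonad Tot f ≫ r = 𝟙 X ∧ r ≫ f = rho adjG.adj.toMonad Tot f) ∧
      (∀ X : M,
        injectiveFibrations (underlying U) (terminal.from X) ↔
          uFibrations (underlying U) (terminal.from X) ∧
            ∃ r : (Tot X).pt ⟶ X, nu adjG.adj.toMonad Tot X ≫ r = 𝟙 X)) := by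
  refine ⟨quillenCounitFibrant_iff_quillenUnitCofibrant adjF adjG, fun hG hS ↦ ?_⟩
  have hSDR {A B : N} {i : A ⟶ B} (h : IsStrongDeformationRetract i) : trivialCofibrations N i :=
    h.trivialCofibrations (hS i h)
  have hU {X Y : M} {f : X ⟶ Y} := uFibrations_of_injectiveFibrations adjF adjG hG (f := f)
  have hR {X Y : M} {f : X ⟶ Y} := injectiveFibrations_of_retraction adjF adjG Tot hG (f := f)
  refine ⟨fun A B i h ↦ hSDR h, fun X Y f ↦ ⟨fun hf ↦ ⟨hU hf, ?_⟩,
    fun ⟨hf, r, hr, hrf⟩ ↦ hR hf r hr hrf⟩, fun X ↦ ⟨fun hX ↦ ⟨hU hX, ?_⟩, fun ⟨hX, r, hr⟩ ↦ ?_⟩⟩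
  -- By (b), `λ_f` is a `U`-acyclic `U`-cofibration; lifting the identity of `X` along it gives the
  -- retraction.
  · have := hf (lam adjG.adj.toMonad Tot f) (hSDR (isStrongDeformationRetract_lam adjF adjG Tot
      hasCopowers_of_simplicialModelCategory f))
    have sq : CommSq (𝟙 X) (lam adjG.adj.toMonad Tot f) f (rho adjG.adj.toMonad Tot f) :=
      ⟨by rw [Category.id_comp, pullback.lift_fst]⟩
    exact ⟨sq.lift, sq.fac_left, sq.fac_right⟩
  · have := hX (nu adjG.adj.toMonad Tot X) (hSDR (isStrongDeformationRetract_nu adjF adjG Tot X))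
    have sq : CommSq (𝟙 X) (nu adjG.adj.toMonad Tot X) (terminal.from X) (terminal.from _) :=
      ⟨Subsingleton.elim _ _⟩
    exact ⟨sq.lift, sq.fac_left⟩
  -- Over the terminal object a retraction of `ν_X` yields one of `λ` by projecting first, with no
  -- need to identify the totalization at the terminal object.
  · refine hR hX (pullback.snd _ _ ≫ r) ?_ (Subsingleton.elim _ _)
    rw [pullback.lift_snd_assoc, hr]
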